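/- Throughout, rings have an identity. A ring $R$ is *clean* if every element of $R$ is the sum of a unit and an idempotent; *weakly clean* if every element of $R$ is the sum or the difference of a unit and an idempotent; *feebly clean* if every element of $R$ can be written as $u+e_1-e_2$ with $u$ a unit and $e_1,e_2$ orthogonal idempotents. For a prime $p$, $\mathbb{Z}_{(p)}$ is the localization of $\mathbb{Z}$ at the prime ideal $p\mathbb{Z}$, $R[G]$ is the group ring of $G$ over $R$, $\zeta_n$ is a primitive $n$-th root of unity in $\mathbb{C}$, $C_n$ is the cyclic group of order $n$, $\varphi$ is Euler's function, and for coprime positive integers $m,n$, $\operatorname{ord}_n m$ is the multiplicative order of $m$ modulo $n$; $m$ is a primitive root modulo $n$ if $\operatorname{ord}_n m=\varphi(n)$. **Theorem.** Let $p\neq 2$ be a prime and let $G$ be a finite abelian group of exponent $n$ with $p\nmid n$. Then: 1. $\mathbb{Z}_{(p)}[G]$ is clean if and only if $\mathbb{Z}_{(p)}[\zeta_n]$ is clean, if and only if $p$ is a primitive root modulo $n$. 2. $\mathbb{Z}_{(p)}[G]$ is feebly clean but not clean if and only if $\mathbb{Z}_{(p)}[\zeta_n]$ is feebly clean but not clean,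 if and only if $\varphi(n)=2\operatorname{ord}_n p$. 3. $\mathbb{Z}_{(p)}[G]$ is weakly clean but not clean if and only if $G\cong C_n$ and one of the following holds: - (a) $n=4$ and $p\equiv 1\pmod 4$, or $n=8$ and $p\equiv 3\pmod 4$; - (b) $n$ is an odd prime with $\operatorname{ord}_n p=(n-1)/2$; - (c) $n=4q$ for some odd prime $q$, $p\equiv 3\pmod 4$, and $p$ is a primitive root modulo $q$; - (d) $n=q_1q_2$ is a product of two distinct primes, $p$ is a primitive root modulo both $q_1$ and $q_2$, and $\gcd(q_1-1,q_2-1)=2$. -/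

import Mathlib

/-- A ring is *clean* if every element is the sum of a unit and an idempotent. -/
def IsCleanRing (R : Type*) [Ring R] : Prop :=
  ∀ r : R, ∃ u e : R, IsUnit u ∧ IsIdempotentElem e ∧ r = u + e

/-- A ring is *weakly clean* if every element is either the sum or the difference of a unit
and an idempotent. -/
def IsWeaklyCleanRing (R : Type*) [Ring R] : Prop :=
  ∀ r : R, ∃ u e : R, IsUnit u ∧ IsIdempotentElem e ∧ (r = u + e ∨ r = u - e)

/-- A ring is *feebly clean* if every element is of the form `u + e₁ - e₂` with `u` a unit and
`e₁`, `e₂` orthogonal idempotents. -/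
def IsFeeblyCleanRing (R : Type*) [Ring R] : Prop :=
  ∀ r : R, ∃ u e₁ e₂ : R, IsUnit u ∧ IsIdempotentElem e₁ ∧ IsIdempotentElem e₂ ∧
    e₁ * e₂ = 0 ∧ e₂ * e₁ = 0 ∧ r = u + e₁ - e₂

/-- The ideal `pℤ` is prime. -/
instance isPrime_span_natCast (p : ℕ) [hp : Fact p.Prime] :
    (Ideal.span {(p : ℤ)}).IsPrime :=
  (Ideal.span_singleton_prime (Int.natCast_ne_zero.mpr hp.out.ne_zero)).mpr
    (Nat.prime_iff_prime_int.mp hp.out)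

/-- `ℤ_(p)`, the localization of `ℤ` at the prime ideal `pℤ`, realized inside `ℚ` as the
ring of fractions `a / s` with `a s : ℤ` and `s ∉ pℤ`. -/
noncomputable abbrev ZLoc (p : ℕ) [Fact p.Prime] : Subalgebra ℤ ℚ :=
  Localization.subalgebra.ofField ℚ (Ideal.span {(p : ℤ)}).primeCompl
    (Ideal.primeCompl_le_nonZeroDivisors _)

/-- `ℤ_(p)` is the localization of `ℤ` at `pℤ` in the sense of Mathlib. -/
instance isLocalization_ZLoc (p : ℕ) [Fact p.Prime] :
    IsLocalization.AtPrime (ZLoc p) (Ideal.span {(p : ℤ)}) :=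
  inferInstanceAs (IsLocalization (Ideal.span {(p : ℤ)}).primeCompl
    (Localization.subalgebra.ofField ℚ (Ideal.span {(p : ℤ)}).primeCompl _))

/-- `ℤ_(p)[ζ_n]`, the subring of `ℂ` generated over `ℤ_(p)` by the primitive `n`-th root of
unity `ζ_n = exp (2πi / n)`. -/
noncomputable abbrev ZLocZeta (p : ℕ) [Fact p.Prime] (n : ℕ) : Subalgebra (ZLoc p) ℂ :=
  Algebra.adjoin (ZLoc p) {Complex.exp (2 * Real.pi * Complex.I / n)}

/-- The integer `m` is a primitive root modulo `n`: it is coprime to `n` and its multiplicative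
order modulo `n` is `φ(n)`. -/
def IsPrimitiveRootMod (m n : ℕ) : Prop :=
  m.Coprime n ∧ orderOf (m : ZMod n) = Nat.totient n

/-! ### Cleanness conditions under surjections and isomorphisms -/

section Transfer

variable {R S : Type*} [Ring R] [Ring S]

/-! Extend the complex characters of `G` to `ℤ_(p)[G]`. Their kernels intersect in zero, and
distinct kernels are comaximal because the exponent `n` is a unit in `ℤ_(p)`. Hence the group ring
is a product of domains `ℤ_(p)[ζ_d]`, one for each cyclic subgroup of the character group, `d` being
its order (`nonempty_monoidAlgebra_equiv_pi`); every `d ∣ n` occurs.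

In each factor the only idempotents are 0 and 1 and 2 is a unit, so clean means one maximal ideal,
and feebly or weakly clean means at most two. Maximal ideals of `ℤ_(p)[ζ_d]` correspond to
irreducible factors of the `d`-th cyclotomic polynomial modulo `p`, so there are `residueIndex p d =
φ(d) / ord_d p` of them. This is the index of `⟨p⟩` in `(ℤ/d)ˣ`, so it divides `residueIndex p n`.
Clean and feebly clean are tested factor by factor, and the factor with `d = n` decides.

A weakly clean product tolerates only one non-clean factor, since one sign serves all coordinates.
Therefore the character group has a single cyclic subgroup of order `n`, which makes `G` cyclic, and
`n` is minimal for divisibility among the moduli of index different from 1. The list (a)–(d) is the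
solution of this arithmetic condition, `residueIndex_eq_two_minimal_iff`. -/

theorem IsCleanRing.of_surjective (f : R →+* S) (hf : Function.Surjective f)
    (h : IsCleanRing R) : IsCleanRing S := by
  intro s
  obtain ⟨r, rfl⟩ := hf s
  obtain ⟨u, e, hu, he, rfl⟩ := h r
  exact ⟨f u, f e, hu.map f, he.map f, map_add f u e⟩

theorem IsWeaklyCleanRing.of_surjective (f : R →+* S) (hf : Function.Surjective f)
    (h : IsWeaklyCleanRing R) : IsWeaklyCleanRing S := by
  intro s
  obtain ⟨r, rfl⟩ := hf s
  obtain ⟨u, e, hu, he, hr⟩ := h r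
  refine ⟨f u, f e, hu.map f, he.map f, ?_⟩
  rcases hr with rfl | rfl
  · exact Or.inl (map_add f u e)
  · exact Or.inr (map_sub f u e)

theorem IsFeeblyCleanRing.of_surjective (f : R →+* S) (hf : Function.Surjective f)
    (h : IsFeeblyCleanRing R) : IsFeeblyCleanRing S := by
  intro s
  obtain ⟨r, rfl⟩ := hf s
  obtain ⟨u, e, e', hu, he, he', h1, h2, rfl⟩ := h r
  exact ⟨f u, f e, f e', hu.map f, he.map f, he'.map f, by rw [← map_mul, h1, map_zero],
    by rw [← map_mul, h2, map_zero], by simp⟩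

theorem isCleanRing_congr (f : R ≃+* S) : IsCleanRing R ↔ IsCleanRing S :=
  ⟨.of_surjective f.toRingHom f.surjective, .of_surjective f.symm.toRingHom f.symm.surjective⟩

theorem isWeaklyCleanRing_congr (f : R ≃+* S) : IsWeaklyCleanRing R ↔ IsWeaklyCleanRing S :=
  ⟨.of_surjective f.toRingHom f.surjective, .of_surjective f.symm.toRingHom f.symm.surjective⟩

theorem isFeeblyCleanRing_congr (f : R ≃+* S) : IsFeeblyCleanRing R ↔ IsFeeblyCleanRing S :=
  ⟨.of_surjective f.toRingHom f.surjective, .of_surjective f.symm.toRingHom f.symm.surjective⟩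

theorem IsCleanRing.exists_sub (h : IsCleanRing R) (r : R) :
    ∃ u e : R, IsUnit u ∧ IsIdempotentElem e ∧ r = u - e := by
  obtain ⟨u, e, hu, he, hr⟩ := h (-r)
  exact ⟨-u, e, hu.neg, he, by rw [← neg_neg r, hr]; abel⟩

end Transfer

/-! ### Products of rings -/

section Pi

variable {ι : Type*} {A : ι → Type*} [∀ i, Ring (A i)]

theorem isCleanRing_pi_iff : IsCleanRing (∀ i, A i) ↔ ∀ i, IsCleanRing (A i) := by
  constructor
  · exact fun h i => h.of_surjective (Pi.evalRingHom A i) (Function.surjective_eval i)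
  · intro h r
    choose u e hu he hr using fun i => h i (r i)
    exact ⟨u, e, Pi.isUnit_iff.mpr hu, funext he, funext hr⟩

theorem isFeeblyCleanRing_pi_iff :
    IsFeeblyCleanRing (∀ i, A i) ↔ ∀ i, IsFeeblyCleanRing (A i) := by
  constructor
  · exact fun h i => h.of_surjective (Pi.evalRingHom A i) (Function.surjective_eval i)
  · intro h r
    choose u e e' hu he he' h1 h2 hr using fun i => h i (r i)
    exact ⟨u, e, e', Pi.isUnit_iff.mpr hu, funext he, funext he', funext h1, funext h2, funext hr⟩

/-- The sign is dictated by coordinate `i`; the clean coordinates can follow either sign, by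
`IsCleanRing.exists_sub`. -/
theorem IsWeaklyCleanRing.pi (i : ι) (hi : IsWeaklyCleanRing (A i))
    (h : ∀ j, j ≠ i → IsCleanRing (A j)) : IsWeaklyCleanRing (∀ i, A i) := by
  intro r
  obtain ⟨u₀, e₀, hu₀, he₀, hr₀⟩ := hi (r i)
  rcases hr₀ with hr₀ | hr₀
  · have key : ∀ j, ∃ u e : A j, IsUnit u ∧ IsIdempotentElem e ∧ r j = u + e := by
      intro j
      by_cases hj : j = i
      · subst hj
        exact ⟨u₀, e₀, hu₀, he₀, hr₀⟩
      · exact h j hj (r j)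
    choose u e hu he hr using key
    exact ⟨u, e, Pi.isUnit_iff.mpr hu, funext he, Or.inl (funext hr)⟩
  · have key : ∀ j, ∃ u e : A j, IsUnit u ∧ IsIdempotentElem e ∧ r j = u - e := by
      intro j
      by_cases hj : j = i
      · subst hj
        exact ⟨u₀, e₀, hu₀, he₀, hr₀⟩
      · exact (h j hj).exists_sub (r j)
    choose u e hu he hr using key
    exact ⟨u, e, Pi.isUnit_iff.mpr hu, funext he, Or.inr (funext hr)⟩

/-- One sign has to serve all coordinates. If `a` and `b` are not sums of a unit and an idempotent,
then `a` in coordinate `i` rules out the plus sign and `-b` in coordinate `j` rules out the minus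
sign. -/
theorem isCleanRing_of_isWeaklyCleanRing_pi {i j : ι} (hij : i ≠ j)
    (h : IsWeaklyCleanRing (∀ i, A i)) : IsCleanRing (A i) ∨ IsCleanRing (A j) := by
  classical
  by_contra! hc
  obtain ⟨hi, hj⟩ := hc
  unfold IsCleanRing at hi hj
  push Not at hi hj
  obtain ⟨a, ha⟩ := hi
  obtain ⟨b, hb⟩ := hj
  obtain ⟨u, e, hu, he, hr⟩ := h (Function.update (Function.update 0 j (-b)) i a)
  have hu := Pi.isUnit_iff.mp hu
  rcases hr with hr | hr
  · have := congrFun hr i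
    rw [Function.update_self] at this
    exact ha (u i) (e i) (hu i) (congrFun he i) this
  · have := congrFun hr j
    rw [Function.update_of_ne hij.symm, Function.update_self] at this
    refine hb (-u j) (e j) (hu j).neg (congrFun he j) ?_
    rw [← neg_neg b, this, Pi.sub_apply]
    abel

end Pi

/-! ### Domains: counting maximal ideals -/

section Domain

variable {A : Type*} [CommRing A] [IsDomain A]

theorem isCleanRing_iff_isUnit : IsCleanRing A ↔ ∀ r : A, IsUnit r ∨ IsUnit (r - 1) := by
  refine forall_congr' fun r => ⟨?_, ?_⟩
  · rintro ⟨u, e, hu, he, rfl⟩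
    rcases IsIdempotentElem.iff_eq_zero_or_one.mp he with rfl | rfl
    · exact Or.inl (by simpa using hu)
    · exact Or.inr (by simpa using hu)
  · rintro (h | h)
    · exact ⟨r, 0, h, .zero, by simp⟩
    · exact ⟨r - 1, 1, h, .one, by simp⟩

theorem isFeeblyCleanRing_iff_isUnit :
    IsFeeblyCleanRing A ↔ ∀ r : A, IsUnit r ∨ IsUnit (r - 1) ∨ IsUnit (r + 1) := by
  refine forall_congr' fun r => ⟨?_, ?_⟩
  · rintro ⟨u, e, e', hu, he, he', h1, -, rfl⟩
    rcases IsIdempotentElem.iff_eq_zero_or_one.mp he with rfl | rfl <;>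
    rcases IsIdempotentElem.iff_eq_zero_or_one.mp he' with rfl | rfl
    · exact Or.inl (by simpa using hu)
    · exact Or.inr (Or.inr (by simpa using hu))
    · exact Or.inr (Or.inl (by simpa using hu))
    · simp at h1
  · rintro (h | h | h)
    · exact ⟨r, 0, 0, h, .zero, .zero, by simp⟩
    · exact ⟨r - 1, 1, 0, h, .one, .zero, by simp⟩
    · exact ⟨r + 1, 0, 1, h, .zero, .one, by simp⟩

theorem isWeaklyCleanRing_iff_isFeeblyCleanRing :
    IsWeaklyCleanRing A ↔ IsFeeblyCleanRing A := by
  rw [isFeeblyCleanRing_iff_isUnit]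
  refine forall_congr' fun r => ⟨?_, ?_⟩
  · rintro ⟨u, e, hu, he, rfl | rfl⟩ <;>
    rcases IsIdempotentElem.iff_eq_zero_or_one.mp he with rfl | rfl
    · exact Or.inl (by simpa using hu)
    · exact Or.inr (Or.inl (by simpa using hu))
    · exact Or.inl (by simpa using hu)
    · exact Or.inr (Or.inr (by simpa using hu))
  · rintro (h | h | h)
    · exact ⟨r, 0, h, .zero, by simp⟩
    · exact ⟨r - 1, 1, h, .one, by simp⟩
    · exact ⟨r + 1, 1, h, .one, by simp⟩

theorem isCleanRing_iff_card_maximalSpectrum [Finite (MaximalSpectrum A)] :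
    IsCleanRing A ↔ Nat.card (MaximalSpectrum A) = 1 := by
  rw [isCleanRing_iff_isUnit, Nat.card_eq_one_iff_unique]
  constructor
  · intro h
    have : IsLocalRing A := .of_isUnit_or_isUnit_one_sub_self fun a =>
      (h a).imp id fun h => by simpa using h.neg
    refine ⟨⟨fun a b => MaximalSpectrum.ext ?_⟩, inferInstance⟩
    rw [IsLocalRing.eq_maximalIdeal a.isMaximal, IsLocalRing.eq_maximalIdeal b.isMaximal]
  · rintro ⟨h, -⟩ r
    by_contra! hr
    obtain ⟨M, hM, h1⟩ := exists_max_ideal_of_mem_nonunits hr.1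
    obtain ⟨N, hN, h2⟩ := exists_max_ideal_of_mem_nonunits hr.2
    have : M = N := congrArg MaximalSpectrum.asIdeal (h.elim ⟨M, hM⟩ ⟨N, hN⟩)
    subst this
    exact hM.ne_top ((Ideal.eq_top_iff_one M).mpr (by simpa using M.sub_mem h1 h2))

/-- Given three maximal ideals, the Chinese remainder theorem yields `r` congruent to 0, 1, -1
modulo them, so `r`, `r - 1`, `r + 1` are all nonunits. Conversely, maximal ideals containing these
three elements are distinct, because the pairwise differences are 1, 1 and 2 up to sign, all units.
-/
theorem isFeeblyCleanRing_iff_card_maximalSpectrum [Finite (MaximalSpectrum A)]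
    (h2 : IsUnit (2 : A)) : IsFeeblyCleanRing A ↔ Nat.card (MaximalSpectrum A) ≤ 2 := by
  rw [isFeeblyCleanRing_iff_isUnit]
  constructor
  · intro h
    by_contra! hc
    have := Fintype.ofFinite (MaximalSpectrum A)
    rw [Nat.card_eq_fintype_card, Fintype.two_lt_card_iff] at hc
    obtain ⟨a, b, c, hab, hac, hbc⟩ := hc
    have hf : Function.Injective ![a, b, c] := by
      intro i j
      fin_cases i <;> fin_cases j <;> simp [hab, hac, hbc, hab.symm, hac.symm, hbc.symm]
    have hcop : Pairwise (Function.onFun IsCoprime fun i => (![a, b, c] i).asIdeal) := by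
      intro i j hij
      exact Ideal.isCoprime_of_isMaximal fun h => hij (hf (MaximalSpectrum.ext h))
    obtain ⟨r, hr⟩ := Ideal.exists_forall_sub_mem_ideal hcop ![0, 1, -1]
    rcases h r with h | h | h
    · exact a.isMaximal.ne_top (Ideal.eq_top_of_isUnit_mem _ (by simpa using hr 0) h)
    · exact b.isMaximal.ne_top (Ideal.eq_top_of_isUnit_mem _ (by simpa using hr 1) h)
    · exact c.isMaximal.ne_top (Ideal.eq_top_of_isUnit_mem _ (by simpa using hr 2) h)
  · intro hle r
    by_contra! hr
    obtain ⟨M, hM, h₁⟩ := exists_max_ideal_of_mem_nonunits hr.1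
    obtain ⟨N, hN, h₂⟩ := exists_max_ideal_of_mem_nonunits hr.2.1
    obtain ⟨L, hL, h₃⟩ := exists_max_ideal_of_mem_nonunits hr.2.2
    have := Fintype.ofFinite (MaximalSpectrum A)
    refine hle.not_gt ?_
    rw [Nat.card_eq_fintype_card, Fintype.two_lt_card_iff]
    refine ⟨⟨M, hM⟩, ⟨N, hN⟩, ⟨L, hL⟩, fun h => ?_, fun h => ?_, fun h => ?_⟩ <;>
      obtain rfl := congrArg MaximalSpectrum.asIdeal h
    · exact hM.ne_top ((Ideal.eq_top_iff_one M).mpr (by simpa using M.sub_mem h₁ h₂))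
    · exact hM.ne_top ((Ideal.eq_top_iff_one M).mpr (by simpa using M.sub_mem h₃ h₁))
    · refine hN.ne_top (Ideal.eq_top_of_isUnit_mem _ (x := 2) ?_ h2)
      convert N.sub_mem h₃ h₂ using 1
      ring

end Domain

theorem isWeaklyCleanRing_pi_and_not_isCleanRing_iff {ι : Type*} {A : ι → Type*}
    [∀ i, CommRing (A i)] [∀ i, IsDomain (A i)] [∀ i, Finite (MaximalSpectrum (A i))]
    (h2 : ∀ i, IsUnit (2 : A i)) :
    IsWeaklyCleanRing (∀ i, A i) ∧ ¬ IsCleanRing (∀ i, A i) ↔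
      ∃ i, Nat.card (MaximalSpectrum (A i)) = 2 ∧
        ∀ j, j ≠ i → Nat.card (MaximalSpectrum (A j)) = 1 := by
  simp only [← isCleanRing_iff_card_maximalSpectrum]
  constructor
  · rintro ⟨hw, hc⟩
    rw [isCleanRing_pi_iff] at hc
    push Not at hc
    obtain ⟨i, hi⟩ := hc
    refine ⟨i, ?_, fun j hj => (isCleanRing_of_isWeaklyCleanRing_pi hj hw).resolve_right hi⟩
    have h := isWeaklyCleanRing_iff_isFeeblyCleanRing.mp
      (hw.of_surjective (Pi.evalRingHom A i) (Function.surjective_eval i))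
    rw [isFeeblyCleanRing_iff_card_maximalSpectrum (h2 i)] at h
    rw [isCleanRing_iff_card_maximalSpectrum] at hi
    have : 0 < Nat.card (MaximalSpectrum (A i)) := Nat.card_pos
    omega
  · rintro ⟨i, hi, h⟩
    refine ⟨.pi i ?_ h, fun hc => ?_⟩
    · rw [isWeaklyCleanRing_iff_isFeeblyCleanRing,
        isFeeblyCleanRing_iff_card_maximalSpectrum (h2 i), hi]
    · have := isCleanRing_pi_iff.mp hc i
      rw [isCleanRing_iff_card_maximalSpectrum] at this
      omega

open Polynomial

/-! ### Maximal ideals of quotients and of polynomial rings -/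

section MaximalSpectrum

/-- If `e : T → A` and `r : T → B` are surjective and every maximal ideal of `A` contains the
image of `ker r`, then the maximal ideals of `A` correspond to those maximal ideals of `B` that
contain the image of `ker e`. -/
noncomputable def maximalSpectrumEquivOfSurjective {T A B : Type*} [CommRing T] [CommRing A]
    [CommRing B] (e : T →+* A) (r : T →+* B) (he : Function.Surjective e)
    (hr : Function.Surjective r)
    (h : ∀ M : Ideal A, M.IsMaximal → RingHom.ker r ≤ M.comap e) :
    MaximalSpectrum A ≃ {N : MaximalSpectrum B // RingHom.ker e ≤ N.asIdeal.comap r} where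
  toFun M := ⟨⟨(M.asIdeal.comap e).map r, by
      have hM := M.isMaximal
      have := Ideal.comap_isMaximal_of_surjective e he (K := M.asIdeal)
      exact Ideal.IsMaximal.map_of_surjective_of_ker_le hr (h _ hM)⟩, by
      rw [Ideal.comap_map_of_surjective' r hr, sup_of_le_left (h _ M.isMaximal)]
      exact Ideal.comap_mono bot_le⟩
  invFun N := ⟨(N.1.asIdeal.comap r).map e, by
      have := N.1.isMaximal
      have := Ideal.comap_isMaximal_of_surjective r hr (K := N.1.asIdeal)
      exact Ideal.IsMaximal.map_of_surjective_of_ker_le he N.2⟩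
  left_inv M := by
    refine MaximalSpectrum.ext ?_
    change ((((M.asIdeal.comap e).map r).comap r).map e) = M.asIdeal
    rw [Ideal.comap_map_of_surjective' r hr, sup_of_le_left (h _ M.isMaximal),
      Ideal.map_comap_of_surjective e he]
  right_inv N := by
    refine Subtype.ext (MaximalSpectrum.ext ?_)
    change ((((N.1.asIdeal.comap r).map e).comap e).map r) = N.1.asIdeal
    rw [Ideal.comap_map_of_surjective' e he, sup_of_le_left N.2,
      Ideal.map_comap_of_surjective r hr]

-- In the principal ideal domain `K[X]` these ideals are generated by the irreducible divisors of
-- `f`, and normalization selects one generator for each.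
open UniqueFactorizationMonoid in
theorem natCard_maximalSpectrum_polynomial {K : Type*} [Field K] [DecidableEq K] {f : K[X]}
    (hf : f ≠ 0) :
    Nat.card {N : MaximalSpectrum K[X] // f ∈ N.asIdeal} =
      (normalizedFactors f).toFinset.card := by
  rw [← Fintype.card_coe, ← Nat.card_eq_fintype_card, eq_comm]
  simp only [Multiset.mem_toFinset]
  refine Nat.card_congr (Equiv.ofBijective (fun P => ⟨⟨Ideal.span {P.1},
    PrincipalIdealRing.isMaximal_of_irreducible (irreducible_of_normalized_factor _ P.2)⟩,
    Ideal.mem_span_singleton.mpr (dvd_of_mem_normalizedFactors P.2)⟩) ⟨?_, ?_⟩)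
  · rintro ⟨P, hP⟩ ⟨Q, hQ⟩ h
    have h' : Ideal.span {P} = Ideal.span {Q} :=
      congrArg (fun N => MaximalSpectrum.asIdeal (Subtype.val N)) h
    rw [Ideal.span_singleton_eq_span_singleton] at h'
    refine Subtype.ext ?_
    exact ((normalize_normalized_factor P hP).symm.trans (normalize_eq_normalize_iff_associated.mpr
      h')).trans (normalize_normalized_factor Q hQ)
  · rintro ⟨⟨N, hN⟩, hfN⟩
    obtain ⟨g, rfl⟩ := (IsPrincipalIdealRing.principal N).principal
    rw [← Ideal.span] at *
    have hgf : g ∣ f := Ideal.mem_span_singleton.mp hfN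
    have hg : g ≠ 0 := ne_zero_of_dvd_ne_zero hf hgf
    have hgi : Irreducible g := ((Ideal.span_singleton_prime hg).mp hN.isPrime).irreducible
    obtain ⟨P, hP, hgP⟩ := exists_mem_normalizedFactors_of_dvd hf hgi hgf
    refine ⟨⟨P, hP⟩, Subtype.ext (MaximalSpectrum.ext ?_)⟩
    exact Ideal.span_singleton_eq_span_singleton.mpr hgP.symm

end MaximalSpectrum

/-! ### Maximal ideals of `ℤ_(p)[ζ_d]` -/

section ZLoc

variable (p : ℕ) [Fact p.Prime]

instance isLocalRing_ZLoc : IsLocalRing (ZLoc p) :=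
  IsLocalization.AtPrime.isLocalRing _ (Ideal.span {(p : ℤ)})

theorem isUnit_intCast_zmod_of_primeCompl (y : (Ideal.span {(p : ℤ)}).primeCompl) :
    IsUnit (Int.castRingHom (ZMod p) y) := by
  rw [isUnit_iff_ne_zero]
  intro h
  exact y.2 (Ideal.mem_span_singleton.mpr ((ZMod.intCast_zmod_eq_zero_iff_dvd _ _).mp h))

/-- Reduction modulo `p` on `ℤ_(p)`. -/
noncomputable def ZLoc.toZMod : ZLoc p →+* ZMod p :=
  IsLocalization.lift (isUnit_intCast_zmod_of_primeCompl p)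

theorem ZLoc.toZMod_surjective : Function.Surjective (ZLoc.toZMod p) := by
  intro x
  obtain ⟨a, rfl⟩ := ZMod.intCast_surjective x
  exact ⟨a, map_intCast _ _⟩

theorem ZLoc.natCast_dvd_of_toZMod_eq_zero {x : ZLoc p} (hx : ZLoc.toZMod p x = 0) :
    (p : ZLoc p) ∣ x := by
  obtain ⟨⟨a, s⟩, h⟩ := IsLocalization.surj (Ideal.span {(p : ℤ)}).primeCompl x
  have hs : IsUnit (algebraMap ℤ (ZLoc p) s) := IsLocalization.map_units _ s
  have ha : ((a : ℤ) : ZMod p) = 0 := by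
    have := congrArg (ZLoc.toZMod p) h
    rw [map_mul, hx, zero_mul] at this
    simpa using this.symm
  rw [← hs.dvd_mul_right, h]
  obtain ⟨b, rfl⟩ := (ZMod.intCast_zmod_eq_zero_iff_dvd _ _).mp ha
  exact ⟨algebraMap ℤ (ZLoc p) b, by simp⟩

theorem ZLoc.isUnit_natCast {m : ℕ} (hm : ¬ p ∣ m) : IsUnit (m : ZLoc p) := by
  have := IsLocalization.map_units (ZLoc p) (⟨(m : ℤ), fun h => hm (by
    exact_mod_cast Ideal.mem_span_singleton.mp h)⟩ : (Ideal.span {(p : ℤ)}).primeCompl)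
  simpa using this

theorem ZLoc.not_isUnit_natCast : ¬ IsUnit (p : ZLoc p) := fun h => by
  simpa using h.map (ZLoc.toZMod p)

variable {p}

/-- Over `ℚ` the cyclotomic polynomial is the minimal polynomial of `ζ`; being monic, it already
divides over `ℤ_(p)`. -/
theorem cyclotomic_dvd_of_aeval_eq_zero {d : ℕ} (hd : 0 < d) {ζ : ℂ} (hζ : IsPrimitiveRoot ζ d)
    {f : (ZLoc p)[X]} (hf : aeval ζ f = 0) : cyclotomic d (ZLoc p) ∣ f := by
  rw [← map_dvd_map (algebraMap (ZLoc p) ℚ) Subtype.val_injective (cyclotomic.monic d _),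
    map_cyclotomic, cyclotomic_eq_minpoly_rat hζ hd]
  exact minpoly.dvd _ _ (by rwa [aeval_map_algebraMap])

theorem aeval_eq_zero_of_cyclotomic_dvd {d : ℕ} (hd : 0 < d) {ζ : ℂ} (hζ : IsPrimitiveRoot ζ d)
    {f : (ZLoc p)[X]} (hf : cyclotomic d (ZLoc p) ∣ f) : aeval ζ f = 0 := by
  refine aeval_eq_zero_of_dvd_aeval_eq_zero hf ?_
  rw [aeval_def, eval₂_eq_eval_map, map_cyclotomic]
  exact hζ.isRoot_cyclotomic hd

theorem isIntegral_of_isPrimitiveRoot {d : ℕ} (hd : 0 < d) {ζ : ℂ} (hζ : IsPrimitiveRoot ζ d) :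
    IsIntegral (ZLoc p) ζ :=
  ⟨cyclotomic d (ZLoc p), cyclotomic.monic d _, aeval_eq_zero_of_cyclotomic_dvd hd hζ dvd_rfl⟩

/-- Evaluation at `ζ_d`, onto `ℤ_(p)[ζ_d]`. -/
noncomputable def evalZeta (p : ℕ) [Fact p.Prime] (d : ℕ) : (ZLoc p)[X] →ₐ[ZLoc p] ZLocZeta p d :=
  aeval ⟨Complex.exp (2 * Real.pi * Complex.I / d), Algebra.self_mem_adjoin_singleton _ _⟩

theorem coe_evalZeta (d : ℕ) (f : (ZLoc p)[X]) :
    (evalZeta p d f : ℂ) = aeval (Complex.exp (2 * Real.pi * Complex.I / d)) f := by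
  exact (aeval_algHom_apply (ZLocZeta p d).val _ f).symm

theorem evalZeta_surjective (d : ℕ) : Function.Surjective (evalZeta p d) := by
  rintro ⟨x, hx⟩
  have hx' : x ∈ Algebra.adjoin (ZLoc p) {Complex.exp (2 * Real.pi * Complex.I / d)} := hx
  rw [Algebra.adjoin_singleton_eq_range_aeval] at hx'
  obtain ⟨f, rfl⟩ := hx'
  exact ⟨f, Subtype.ext (coe_evalZeta d f)⟩

/-- By integrality `M` contracts to a maximal ideal of the local ring `ℤ_(p)`, and `p` is a nonunit
there. -/
theorem natCast_mem_of_isMaximal {d : ℕ} (hd : 0 < d) (M : Ideal (ZLocZeta p d))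
    (hM : M.IsMaximal) : (p : ZLocZeta p d) ∈ M := by
  have : Algebra.IsIntegral (ZLoc p) (ZLocZeta p d) :=
    Algebra.IsIntegral.adjoin fun x hx => by
      rw [Set.mem_singleton_iff.mp hx]
      exact isIntegral_of_isPrimitiveRoot hd (Complex.isPrimitiveRoot_exp d hd.ne')
  have h := Ideal.isMaximal_comap_of_isIntegral_of_isMaximal (R := ZLoc p) M
  have h' : (p : ZLoc p) ∈ M.comap (algebraMap (ZLoc p) (ZLocZeta p d)) := by
    rw [IsLocalRing.eq_maximalIdeal h]
    exact ZLoc.not_isUnit_natCast p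
  simpa using h'

/-- Both `ℤ_(p)[ζ_d]` and `𝔽_p[X]` are quotients of `ℤ_(p)[X]`. As every maximal ideal of the former
contains `p`, these ideals match the maximal ideals of `𝔽_p[X]` containing the cyclotomic
polynomial, whose irreducible factors all have degree `ord_d p`. -/
theorem natCard_maximalSpectrum_ZLocZeta_mul_orderOf {d : ℕ} (hpd : ¬ p ∣ d) :
    Nat.card (MaximalSpectrum (ZLocZeta p d)) * orderOf (p : ZMod d) = d.totient := by
  classical
  have hd : 0 < d := Nat.pos_of_ne_zero fun h => hpd (h ▸ dvd_zero p)
  have hζ := Complex.isPrimitiveRoot_exp d hd.ne'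
  have hcop : p.Coprime d := (Fact.out : p.Prime).coprime_iff_not_dvd.mpr hpd
  let r : (ZLoc p)[X] →+* (ZMod p)[X] := mapRingHom (ZLoc.toZMod p)
  have hr : Function.Surjective r := map_surjective _ (ZLoc.toZMod_surjective p)
  have key := Nat.card_congr <| maximalSpectrumEquivOfSurjective (evalZeta p d).toRingHom r
    (evalZeta_surjective d) hr (by
      intro M hM f hf
      have hpf : C (p : ZLoc p) ∣ f := by
        rw [C_dvd_iff_dvd_coeff]
        intro i
        refine ZLoc.natCast_dvd_of_toZMod_eq_zero p ?_
        have : (r f).coeff i = 0 := by rw [(RingHom.mem_ker).mp hf, coeff_zero]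
        simpa [r] using this
      obtain ⟨g, rfl⟩ := hpf
      rw [Ideal.mem_comap, map_mul]
      refine M.mul_mem_right _ ?_
      simpa using natCast_mem_of_isMaximal hd M hM)
  have hker : ∀ N : Ideal (ZMod p)[X],
      RingHom.ker (evalZeta p d).toRingHom ≤ N.comap r ↔ cyclotomic d (ZMod p) ∈ N := by
    intro N
    constructor
    · intro h
      have : cyclotomic d (ZLoc p) ∈ RingHom.ker (evalZeta p d).toRingHom := by
        rw [RingHom.mem_ker]
        refine Subtype.ext ?_
        exact (coe_evalZeta d _).trans (aeval_eq_zero_of_cyclotomic_dvd hd hζ dvd_rfl)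
      simpa [r] using h this
    · intro h f hf
      have hf' : aeval (Complex.exp (2 * Real.pi * Complex.I / d)) f = 0 := by
        rw [← coe_evalZeta, show evalZeta p d f = 0 from hf]
        rfl
      obtain ⟨g, rfl⟩ := cyclotomic_dvd_of_aeval_eq_zero hd hζ hf'
      rw [Ideal.mem_comap, map_mul]
      refine N.mul_mem_right _ ?_
      simpa [r] using h
  simp only [hker] at key
  rw [key, natCard_maximalSpectrum_polynomial (cyclotomic_ne_zero d _),
    -- Here `f` is the exponent in the cardinality `p ^ f` of the finite field.
    normalizedFactors_cyclotomic_card (f := 1) (p := p) (by simp) hcop]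
  have h1 : orderOf (p : ZMod d) = orderOf (ZMod.unitOfCoprime _ (hcop.pow_left 1)) := by
    rw [← orderOf_units]
    simp
  rw [h1]
  refine Nat.div_mul_cancel ?_
  have : NeZero d := ⟨hd.ne'⟩
  rw [← ZMod.card_units_eq_totient]
  exact orderOf_dvd_card

end ZLoc

/-! ### Characters and the decomposition of the group ring -/

section Characters

variable {G : Type*} [CommGroup G]

theorem exists_isPrimitiveRoot_apply [Finite G] (χ : G →* ℂˣ) :
    ∃ g₀ : G, IsPrimitiveRoot (χ g₀ : ℂ) (orderOf χ) ∧ ∀ g, ∃ m : ℕ, χ g = χ g₀ ^ m := by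
  have : Finite χ.range := Set.finite_range χ
  obtain ⟨⟨_, g₀, rfl⟩, hg₀⟩ := IsCyclic.exists_generator (α := χ.range)
  have hpow : ∀ g, ∃ m : ℕ, χ g = χ g₀ ^ m := by
    intro g
    obtain ⟨m, hm⟩ := (isOfFinOrder_of_finite _).mem_powers_iff_mem_zpowers.mpr
      (hg₀ ⟨χ g, g, rfl⟩)
    exact ⟨m, (congrArg Subtype.val hm).symm⟩
  refine ⟨g₀, ?_, hpow⟩
  rw [IsPrimitiveRoot.coe_units_iff]
  have : orderOf χ = orderOf (χ g₀) := by
    refine orderOf_eq_orderOf_iff.mpr fun m => ⟨fun h => ?_, fun h => ?_⟩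
    · rw [← MonoidHom.pow_apply, h, MonoidHom.one_apply]
    · ext g
      obtain ⟨k, hk⟩ := hpow g
      rw [MonoidHom.pow_apply, hk, pow_right_comm, h, one_pow, MonoidHom.one_apply]
  rw [this]
  exact IsPrimitiveRoot.orderOf _

/-- Modulo `χ.ker` the group is generated by `g₀`, so `ψ` is determined by `ψ g₀`. This value is an
`orderOf χ`-th root of unity, hence a power of the primitive one `χ g₀`. -/
theorem mem_zpowers_of_ker_le [Finite G] {χ ψ : G →* ℂˣ} (h : χ.ker ≤ ψ.ker) :
    ∃ j : ℕ, ψ = χ ^ j := by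
  obtain ⟨g₀, hg₀, hpow⟩ := exists_isPrimitiveRoot_apply χ
  have h1 : (ψ g₀ : ℂ) ^ orderOf χ = 1 := by
    have : g₀ ^ orderOf χ ∈ χ.ker := by
      rw [MonoidHom.mem_ker, map_pow, ← MonoidHom.pow_apply, pow_orderOf_eq_one,
        MonoidHom.one_apply]
    have := h this
    rw [MonoidHom.mem_ker, map_pow] at this
    rw [← Units.val_pow_eq_pow_val, this, Units.val_one]
  have : NeZero (orderOf χ) := ⟨(orderOf_pos χ).ne'⟩
  obtain ⟨j, -, hj⟩ := hg₀.eq_pow_of_pow_eq_one h1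
  have hj : χ g₀ ^ j = ψ g₀ := by exact_mod_cast hj
  refine ⟨j, MonoidHom.ext fun g => ?_⟩
  obtain ⟨m, hm⟩ := hpow g
  have hk : g * (g₀ ^ m)⁻¹ ∈ χ.ker := by
    rw [MonoidHom.mem_ker, map_mul, hm, map_inv, map_pow, mul_inv_cancel]
  have hk := h hk
  rw [MonoidHom.mem_ker, map_mul, map_inv, mul_inv_eq_one, map_pow] at hk
  rw [hk, MonoidHom.pow_apply, hm, ← hj, pow_right_comm]

theorem zpowers_eq_of_ker_eq [Finite G] {χ ψ : G →* ℂˣ} (h : χ.ker = ψ.ker) :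
    Subgroup.zpowers χ = Subgroup.zpowers ψ := by
  obtain ⟨i, hi⟩ := mem_zpowers_of_ker_le h.le
  obtain ⟨j, hj⟩ := mem_zpowers_of_ker_le h.ge
  refine le_antisymm ?_ ?_
  · rw [Subgroup.zpowers_le, hj]
    exact Subgroup.npow_mem_zpowers ψ j
  · rw [Subgroup.zpowers_le, hi]
    exact Subgroup.npow_mem_zpowers χ i

theorem sum_characters_eq_zero [Finite G] [Fintype (G →* ℂˣ)] {g : G} (hg : g ≠ 1) :
    ∑ χ : G →* ℂˣ, (χ g : ℂ) = 0 := by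
  have : NeZero (Monoid.exponent G) := ⟨Monoid.exponent_ne_zero_of_finite⟩
  obtain ⟨φ, hφ⟩ := CommGroup.exists_apply_ne_one_of_hasEnoughRootsOfUnity G ℂ hg
  have h : (φ g : ℂ) * ∑ χ : G →* ℂˣ, (χ g : ℂ) = ∑ χ : G →* ℂˣ, (χ g : ℂ) := by
    rw [Finset.mul_sum]
    refine Fintype.sum_equiv (Equiv.mulLeft φ) _ _ fun χ => ?_
    simp
  have h' : ((φ g : ℂ) - 1) * ∑ χ : G →* ℂˣ, (χ g : ℂ) = 0 := by
    rw [sub_mul, h, one_mul, sub_self]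
  refine (mul_eq_zero.mp h').resolve_left ?_
  rwa [sub_eq_zero, Units.val_eq_one]

variable (p : ℕ) [Fact p.Prime]

/-- The extension of a character to the group ring. -/
noncomputable def charHom (χ : G →* ℂˣ) : MonoidAlgebra (ZLoc p) G →ₐ[ZLoc p] ℂ :=
  MonoidAlgebra.lift (ZLoc p) ℂ G ((Units.coeHom ℂ).comp χ)

/-- The kernel of the extension of a character to the group ring. -/
noncomputable def charKer (χ : G →* ℂˣ) : Ideal (MonoidAlgebra (ZLoc p) G) :=
  RingHom.ker (charHom p χ)

variable {p}

theorem mem_charKer {χ : G →* ℂˣ} {f : MonoidAlgebra (ZLoc p) G} :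
    f ∈ charKer p χ ↔ charHom p χ f = 0 := RingHom.mem_ker

@[simp] theorem charHom_of (χ : G →* ℂˣ) (g : G) :
    charHom p χ (MonoidAlgebra.of (ZLoc p) G g) = χ g := by
  simp [charHom]

theorem charHom_apply [Fintype G] (χ : G →* ℂˣ) (f : MonoidAlgebra (ZLoc p) G) :
    charHom p χ f = ∑ g, algebraMap (ZLoc p) ℂ (f.coeff g) * χ g := by
  rw [charHom, MonoidAlgebra.lift_apply']
  rw [Finsupp.sum_fintype _ _ (by simp)]
  rfl

/-- Galois conjugation: all values of `χ` are powers of `χ g₀`, so `f` is sent to `F (χ g₀)` for a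
polynomial `F` over `ℤ_(p)`. If this vanishes, a cyclotomic polynomial divides `F`, and `F` vanishes
at the conjugate `χ g₀ ^ j` too. -/
theorem charKer_le_charKer_pow [Finite G] (χ : G →* ℂˣ) {j : ℕ} (hj : j.Coprime (orderOf χ)) :
    charKer p χ ≤ charKer p (χ ^ j) := by
  have := Fintype.ofFinite G
  obtain ⟨g₀, hg₀, hpow⟩ := exists_isPrimitiveRoot_apply χ
  choose m hm using hpow
  intro f hf
  let F : (ZLoc p)[X] := ∑ g, C (f.coeff g) * X ^ m g
  have key : ∀ i : ℕ, charHom p (χ ^ i) f = aeval ((χ g₀ : ℂ) ^ i) F := by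
    intro i
    rw [charHom_apply, map_sum]
    refine Finset.sum_congr rfl fun g _ => ?_
    rw [map_mul, map_pow, aeval_C, aeval_X, MonoidHom.pow_apply, hm, Units.val_pow_eq_pow_val,
      Units.val_pow_eq_pow_val, pow_right_comm]
  rw [mem_charKer] at hf ⊢
  rw [key]
  refine aeval_eq_zero_of_cyclotomic_dvd (orderOf_pos χ) (hg₀.pow_of_coprime j hj) ?_
  refine cyclotomic_dvd_of_aeval_eq_zero (orderOf_pos χ) hg₀ ?_
  have h1 := (key 1).symm
  rwa [pow_one, pow_one χ, hf] at h1

theorem charKer_eq_of_zpowers_eq [Finite G] {χ ψ : G →* ℂˣ}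
    (h : Subgroup.zpowers χ = Subgroup.zpowers ψ) : charKer p χ = charKer p ψ := by
  have key : ∀ {χ ψ : G →* ℂˣ}, Subgroup.zpowers χ = Subgroup.zpowers ψ →
      charKer p χ ≤ charKer p ψ := by
    intro χ ψ h
    have h1 : ψ ∈ Subgroup.zpowers χ := h ▸ Subgroup.mem_zpowers ψ
    obtain ⟨j, rfl⟩ := (isOfFinOrder_of_finite χ).mem_powers_iff_mem_zpowers.mpr h1
    change Subgroup.zpowers χ = Subgroup.zpowers (χ ^ j) at h
    have ho : orderOf (χ ^ j) = orderOf χ := by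
      rw [← Nat.card_zpowers, ← Nat.card_zpowers]
      exact congrArg (fun H : Subgroup (G →* ℂˣ) => Nat.card H) h.symm
    refine charKer_le_charKer_pow χ ?_
    rw [orderOf_pow χ] at ho
    have := (Nat.div_eq_self.mp ho).resolve_left (orderOf_pos χ).ne'
    rwa [Nat.coprime_comm]
  exact le_antisymm (key h) (key h.symm)

/-- If `χ g ≠ 1`, the geometric sum of the powers of `g` up to the exponent `n` lies in `charKer p
χ`. If also `g ≡ 1` modulo `M`, that sum is congruent to `n`, a unit as `p ∤ n`, so `M` could not be
proper. Thus a proper ideal above two character kernels forces the characters to have the same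
kernel in `G`. -/
theorem mem_ker_iff_of_charKer_le [Finite G] {χ : G →* ℂˣ} {M : Ideal (MonoidAlgebra (ZLoc p) G)}
    (hM : M ≠ ⊤) (hp : ¬ p ∣ Monoid.exponent G) (h : charKer p χ ≤ M) (g : G) :
    g ∈ χ.ker ↔ MonoidAlgebra.of (ZLoc p) G g - 1 ∈ M := by
  set x := MonoidAlgebra.of (ZLoc p) G g with hx
  constructor
  · intro hg
    refine h (mem_charKer.mpr ?_)
    rw [map_sub, map_one, hx, charHom_of, (MonoidHom.mem_ker).mp hg, Units.val_one, sub_self]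
  · intro hg
    by_contra hne
    rw [MonoidHom.mem_ker] at hne
    set n := Monoid.exponent G
    have h0 : ∑ i ∈ Finset.range n, x ^ i ∈ M := by
      refine h (mem_charKer.mpr ?_)
      have h1 : ((χ g : ℂ) - 1) ≠ 0 := by
        rwa [sub_ne_zero, Ne, Units.val_eq_one]
      refine mul_right_cancel₀ h1 ?_
      rw [map_sum]
      simp only [map_pow, hx, charHom_of]
      rw [geom_sum_mul, zero_mul, sub_eq_zero]
      have : χ g ^ n = 1 := by rw [← map_pow, Monoid.pow_exponent_eq_one, map_one]
      rw [← Units.val_pow_eq_pow_val, this, Units.val_one]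
    have h2 : ∑ i ∈ Finset.range n, (x ^ i - 1) ∈ M :=
      M.sum_mem fun i _ => by
        rw [← geom_sum_mul]
        exact M.mul_mem_left _ hg
    have h3 : (n : MonoidAlgebra (ZLoc p) G) ∈ M := by
      have := M.sub_mem h0 h2
      rw [← Finset.sum_sub_distrib] at this
      simpa using this
    refine hM (Ideal.eq_top_of_isUnit_mem _ h3 ?_)
    simpa using (ZLoc.isUnit_natCast p hp).map (algebraMap (ZLoc p) (MonoidAlgebra (ZLoc p) G))

theorem charKer_ne_top (χ : G →* ℂˣ) : charKer p χ ≠ ⊤ := RingHom.ker_ne_top _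

theorem zpowers_eq_of_not_isCoprime [Finite G] (hp : ¬ p ∣ Monoid.exponent G) {χ ψ : G →* ℂˣ}
    (h : ¬ IsCoprime (charKer p χ) (charKer p ψ)) :
    Subgroup.zpowers χ = Subgroup.zpowers ψ := by
  rw [Ideal.isCoprime_iff_sup_eq] at h
  refine zpowers_eq_of_ker_eq (Subgroup.ext fun g => ?_)
  rw [mem_ker_iff_of_charKer_le h hp le_sup_left, mem_ker_iff_of_charKer_le h hp le_sup_right]

theorem charKer_eq_iff [Finite G] (hp : ¬ p ∣ Monoid.exponent G) {χ ψ : G →* ℂˣ} :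
    charKer p χ = charKer p ψ ↔ Subgroup.zpowers χ = Subgroup.zpowers ψ := by
  refine ⟨fun h => zpowers_eq_of_not_isCoprime hp ?_, charKer_eq_of_zpowers_eq⟩
  rw [h, Ideal.isCoprime_iff_sup_eq, sup_idem]
  exact charKer_ne_top ψ

-- Fourier inversion: weighting the values of `f` by `χ h⁻¹` and summing over all `χ` isolates the
-- coefficient at `h`, up to the nonzero number of characters.
variable (p) in
theorem iInf_charKer [Finite G] : ⨅ χ : G →* ℂˣ, charKer p χ = ⊥ := by
  have := Fintype.ofFinite G
  have := Fintype.ofFinite (G →* ℂˣ)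
  rw [eq_bot_iff]
  intro f hf
  simp only [Ideal.mem_iInf, mem_charKer, charHom_apply] at hf
  rw [Ideal.mem_bot]
  ext h
  have h1 : ∑ χ : G →* ℂˣ, (χ h⁻¹ : ℂ) * ∑ g, algebraMap (ZLoc p) ℂ (f.coeff g) * χ g = 0 :=
    Finset.sum_eq_zero fun χ _ => by rw [hf, mul_zero]
  simp only [Finset.mul_sum] at h1
  rw [Finset.sum_comm] at h1
  have h2 : ∀ g, ∑ χ : G →* ℂˣ, (χ h⁻¹ : ℂ) * (algebraMap (ZLoc p) ℂ (f.coeff g) * χ g) =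
      algebraMap (ZLoc p) ℂ (f.coeff g) * ∑ χ : G →* ℂˣ, (χ (h⁻¹ * g) : ℂ) := by
    intro g
    rw [Finset.mul_sum]
    refine Finset.sum_congr rfl fun χ _ => ?_
    rw [map_mul, Units.val_mul]
    ring
  simp only [h2] at h1
  rw [Finset.sum_eq_single h] at h1
  · have h3 : (Fintype.card (G →* ℂˣ) : ℂ) ≠ 0 := Nat.cast_ne_zero.mpr Fintype.card_ne_zero
    simp only [inv_mul_cancel, map_one, Units.val_one, Finset.sum_const, Finset.card_univ,
      nsmul_eq_mul, mul_one] at h1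
    have h4 := (mul_eq_zero.mp h1).resolve_right h3
    rw [(FaithfulSMul.algebraMap_eq_zero_iff (ZLoc p) ℂ).mp h4]
    rfl
  · intro g _ hg
    rw [sum_characters_eq_zero (by rwa [Ne, inv_mul_eq_one, eq_comm]), mul_zero]
  · simp

theorem range_charHom [Finite G] (χ : G →* ℂˣ) : (charHom p χ).range = ZLocZeta p (orderOf χ) := by
  obtain ⟨g₀, hg₀, hpow⟩ := exists_isPrimitiveRoot_apply χ
  have hζ := Complex.isPrimitiveRoot_exp (orderOf χ) (orderOf_pos χ).ne'
  have : NeZero (orderOf χ) := ⟨(orderOf_pos χ).ne'⟩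
  refine le_antisymm ?_ ?_
  · rintro _ ⟨f, rfl⟩
    have := Fintype.ofFinite G
    change charHom p χ f ∈ _
    rw [charHom_apply]
    refine Subalgebra.sum_mem _ fun g _ =>
      Subalgebra.mul_mem _ (Subalgebra.algebraMap_mem _ _) ?_
    obtain ⟨m, hm⟩ := hpow g
    obtain ⟨j, -, hj⟩ := hζ.eq_pow_of_pow_eq_one hg₀.pow_eq_one
    rw [hm, Units.val_pow_eq_pow_val, ← hj]
    exact Subalgebra.pow_mem _ (Subalgebra.pow_mem _ (Algebra.self_mem_adjoin_singleton _ _) _) _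
  · refine Algebra.adjoin_le ?_
    rw [Set.singleton_subset_iff]
    obtain ⟨j, -, hj⟩ := hg₀.eq_pow_of_pow_eq_one hζ.pow_eq_one
    exact ⟨MonoidAlgebra.of (ZLoc p) G (g₀ ^ j), by
      change charHom p χ _ = _
      rw [charHom_of, map_pow, Units.val_pow_eq_pow_val, hj]⟩

/-- The quotient of the group ring by the kernel of a character `χ` is `ℤ_(p)[ζ_d]`, where `d` is
the order of `χ`. -/
noncomputable def quotientCharKerEquiv [Finite G] (χ : G →* ℂˣ) :
    (MonoidAlgebra (ZLoc p) G ⧸ charKer p χ) ≃+* ZLocZeta p (orderOf χ) :=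
  (RingHom.quotientKerEquivRange (charHom p χ).toRingHom).trans
    (RingEquiv.subringCongr (congrArg Subalgebra.toSubring (range_charHom χ)))

variable (G p) in
/-- The ideals of the group ring that are kernels of characters. -/
abbrev CharKernels : Type _ := Set.range (charKer p : (G →* ℂˣ) → _)

/-- A character with a given kernel. -/
noncomputable def CharKernels.char (P : CharKernels G p) : G →* ℂˣ := P.2.choose

theorem CharKernels.charKer_char (P : CharKernels G p) : charKer p P.char = P.1 := P.2.choose_spec

/-- The decomposition of the group ring into a product of rings of the form `ℤ_(p)[ζ_d]`. -/
theorem nonempty_monoidAlgebra_equiv_pi [Finite G] (hp : ¬ p ∣ Monoid.exponent G) :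
    Nonempty (MonoidAlgebra (ZLoc p) G ≃+*
      ∀ P : CharKernels G p, ZLocZeta p (orderOf P.char)) := by
  -- The index set consists of kernels and not of characters: characters generating the same cyclic
  -- subgroup share a kernel and would not be comaximal.
  have hcop : Pairwise (Function.onFun IsCoprime fun P : CharKernels G p => charKer p P.char) := by
    intro P Q hPQ
    by_contra h
    refine hPQ (Subtype.ext ?_)
    rw [← P.charKer_char, ← Q.charKer_char]
    exact charKer_eq_of_zpowers_eq (zpowers_eq_of_not_isCoprime hp h)
  have hinf : ⨅ P : CharKernels G p, charKer p P.char = ⊥ := by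
    simp only [CharKernels.charKer_char]
    rw [← iInf_charKer (G := G) p, iInf_subtype, iInf_range]
  have e := Ideal.quotientInfRingEquivPiQuotient _ hcop
  exact ⟨(RingEquiv.quotientBot _).symm.trans <| (Ideal.quotEquivOfEq hinf.symm).trans <|
    e.trans (RingEquiv.piCongrRight fun P => quotientCharKerEquiv P.char)⟩

end Characters

/-! ### Elements of maximal order in finite abelian groups -/

section OrderCyclic

variable {A : Type*} [CommGroup A] [Finite A]

/-- If an element of maximal order in a finite abelian group does not generate it, then there is
another one outside of the cyclic subgroup it generates. -/
theorem exists_orderOf_eq_exponent_notMem_zpowers {x : A} (hx : orderOf x = Monoid.exponent A)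
    (htop : Subgroup.zpowers x ≠ ⊤) :
    ∃ y : A, orderOf y = Monoid.exponent A ∧ y ∉ Subgroup.zpowers x := by
  set n := Monoid.exponent A with hn
  set H := Subgroup.zpowers x with hH
  have hn0 : 0 < n := Nat.pos_of_ne_zero Monoid.exponent_ne_zero_of_finite
  -- Lift an element of prime order `q` from `A ⧸ H` and remove the prime-to-`q` part of its order
  -- by a power; that power is prime to `q`, so the result stays outside `H`.
  obtain ⟨q, s, a, hq, ha, haH⟩ : ∃ (q s : ℕ) (a : A), q.Prime ∧ a ^ q ^ s = 1 ∧ a ∉ H := by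
    have hcard : Nat.card (A ⧸ H) ≠ 1 := by
      rw [← Subgroup.index_eq_card]
      exact fun h => htop (Subgroup.index_eq_one.mp h)
    obtain ⟨q, hq, hqd⟩ := Nat.exists_prime_and_dvd hcard
    have := Fact.mk hq
    obtain ⟨b, hb⟩ := exists_prime_orderOf_dvd_card' q hqd
    obtain ⟨b, rfl⟩ := QuotientGroup.mk_surjective b
    obtain ⟨s, m, hm, hbm⟩ := Nat.exists_eq_pow_mul_and_not_dvd (orderOf_pos b).ne' q hq.ne_one
    refine ⟨q, s, b ^ m, hq, ?_, fun h => ?_⟩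
    · rw [← pow_mul, mul_comm, ← hbm, pow_orderOf_eq_one]
    · rw [← QuotientGroup.eq_one_iff, QuotientGroup.mk_pow, ← orderOf_dvd_iff_pow_eq_one, hb] at h
      exact hm h
  have hval : ∀ l, l.Prime → l ∣ n → l ≠ q → a ^ (n / l) = 1 := by
    intro l hl hln hlq
    have h1 : orderOf a ∣ n / l * l := by
      rw [Nat.div_mul_cancel hln]
      exact Monoid.order_dvd_exponent a
    have h2 : (orderOf a).Coprime l :=
      Nat.Coprime.coprime_dvd_left (orderOf_dvd_of_pow_eq_one ha)
        (Nat.Coprime.pow_left s ((Nat.coprime_primes hq hl).mpr hlq.symm))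
    exact orderOf_dvd_iff_pow_eq_one.mp (h2.dvd_of_dvd_mul_right h1)
  have hx1 : ∀ l j, l.Prime → l ∣ n → j.Coprime l → x ^ (j * (n / l)) ≠ 1 := by
    intro l j hl hln hjl h
    rw [← orderOf_dvd_iff_pow_eq_one, hx] at h
    have h3 : 0 < n / l := Nat.div_pos (Nat.le_of_dvd hn0 hln) hl.pos
    obtain ⟨k, hk⟩ := h
    have : j = l * k := by
      refine Nat.eq_of_mul_eq_mul_right h3 ?_
      rw [hk]
      conv_lhs => rw [← Nat.div_mul_cancel hln]
      ring
    rw [this, Nat.Coprime, Nat.gcd_comm, Nat.gcd_mul_right_right] at hjl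
    exact hl.ne_one hjl
  have hmul : ∀ j : ℕ, a * x ^ j ∉ H := by
    intro j h
    exact haH ((Subgroup.mul_mem_cancel_right H (Subgroup.npow_mem_zpowers x j)).mp h)
  have hord : ∀ j : ℕ, (∀ l, l.Prime → l ∣ n → (a * x ^ j) ^ (n / l) ≠ 1) →
      orderOf (a * x ^ j) = n := by
    intro j h
    exact orderOf_eq_of_pow_and_pow_div_prime hn0 (Monoid.pow_exponent_eq_one _) h
  -- If `a` lacks the full `q`-part of `n`, then `a * x` keeps the order of `x`. Otherwise `a`
  -- supplies the `q`-part, and `x ^ q` supplies the other primes while dying in the power `n / q`.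
  by_cases haq : a ^ (n / q) = 1
  · refine ⟨a * x ^ 1, hord 1 fun l hl hln => ?_, hmul 1⟩
    have : a ^ (n / l) = 1 := by
      by_cases hlq : l = q
      · rw [hlq, haq]
      · exact hval l hl hln hlq
    rw [mul_pow, this, one_mul, ← pow_mul]
    exact hx1 l 1 hl hln (Nat.coprime_one_left l)
  · refine ⟨a * x ^ q, hord q fun l hl hln => ?_, hmul q⟩
    by_cases hlq : l = q
    · subst hlq
      rw [mul_pow, ← pow_mul, Nat.mul_div_cancel' hln, Monoid.pow_exponent_eq_one, mul_one]
      exact haq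
    · rw [mul_pow, hval l hl hln hlq, one_mul, ← pow_mul]
      exact hx1 l q hl hln ((Nat.coprime_primes hq hl).mpr (Ne.symm hlq))

end OrderCyclic

/-! ### Arithmetic of the index `φ(d) / ord_d m` -/

section ResidueIndex

/-- The index `φ(d) / ord_d(m)` of the subgroup generated by `m` in `(ℤ/dℤ)ˣ`. -/
noncomputable def residueIndex (m d : ℕ) : ℕ := d.totient / orderOf (m : ZMod d)

variable {m d n a b : ℕ}

theorem orderOf_natCast_zmod (h : m.Coprime d) :
    orderOf (m : ZMod d) = orderOf (ZMod.unitOfCoprime m h) := by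
  rw [← orderOf_units, ZMod.coe_unitOfCoprime]

theorem residueIndex_eq_index [NeZero d] (h : m.Coprime d) :
    residueIndex m d = (Subgroup.zpowers (ZMod.unitOfCoprime m h)).index := by
  rw [residueIndex, orderOf_natCast_zmod h, ← ZMod.card_units_eq_totient,
    ← Nat.card_eq_fintype_card, ← Nat.card_zpowers]
  exact Nat.div_eq_of_eq_mul_left Nat.card_pos (Subgroup.index_mul_card _).symm

theorem residueIndex_mul_orderOf [NeZero d] (h : m.Coprime d) :
    residueIndex m d * orderOf (m : ZMod d) = d.totient := by
  rw [residueIndex_eq_index h, orderOf_natCast_zmod h, ← Nat.card_zpowers, Subgroup.index_mul_card,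
    Nat.card_eq_fintype_card, ZMod.card_units_eq_totient]

theorem orderOf_natCast_zmod_pos [NeZero d] (h : m.Coprime d) : 0 < orderOf (m : ZMod d) := by
  rw [orderOf_natCast_zmod h]
  exact orderOf_pos _

theorem residueIndex_eq_iff [NeZero d] (h : m.Coprime d) {k : ℕ} :
    residueIndex m d = k ↔ d.totient = k * orderOf (m : ZMod d) := by
  rw [← residueIndex_mul_orderOf h, Nat.mul_left_inj (orderOf_natCast_zmod_pos h).ne']

theorem isPrimitiveRootMod_iff [NeZero d] (h : m.Coprime d) :
    IsPrimitiveRootMod m d ↔ residueIndex m d = 1 := by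
  rw [residueIndex_eq_iff h, one_mul, IsPrimitiveRootMod, and_iff_right h, eq_comm]

/-- Reduction maps `(ℤ/n)ˣ` onto `(ℤ/d)ˣ` and `⟨m⟩` onto `⟨m⟩`; the index of the image of a subgroup
under a surjection divides its index. -/
theorem residueIndex_dvd_of_dvd [NeZero n] (h : m.Coprime n) (hd : d ∣ n) :
    residueIndex m d ∣ residueIndex m n := by
  have : NeZero d := ⟨ne_zero_of_dvd_ne_zero (NeZero.ne n) hd⟩
  have h' : m.Coprime d := h.coprime_dvd_right hd
  rw [residueIndex_eq_index h, residueIndex_eq_index h']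
  convert Subgroup.index_map_dvd (Subgroup.zpowers (ZMod.unitOfCoprime m h))
    (ZMod.unitsMap_surjective hd) using 2
  rw [MonoidHom.map_zpowers]
  congr 1
  ext
  simp [ZMod.unitsMap_def]

theorem orderOf_natCast_zmod_mul (hab : a.Coprime b) :
    orderOf (m : ZMod (a * b)) = (orderOf (m : ZMod a)).lcm (orderOf (m : ZMod b)) := by
  have h := orderOf_injective (ZMod.chineseRemainder hab : ZMod (a * b) →* ZMod a × ZMod b)
    (ZMod.chineseRemainder hab).injective (m : ZMod (a * b))
  rw [← h, Prod.orderOf]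
  simp

theorem residueIndex_mul [NeZero a] [NeZero b] (hab : a.Coprime b) (h : m.Coprime (a * b)) :
    residueIndex m (a * b) = residueIndex m a * residueIndex m b *
      (orderOf (m : ZMod a)).gcd (orderOf (m : ZMod b)) := by
  rw [residueIndex_eq_iff h, orderOf_natCast_zmod_mul hab, mul_assoc, Nat.gcd_mul_lcm,
    Nat.totient_mul hab, ← residueIndex_mul_orderOf (h.coprime_dvd_right (Dvd.intro _ rfl)),
    ← residueIndex_mul_orderOf (h.coprime_dvd_right (Dvd.intro_left _ rfl))]
  ring

/-- Both totients are even. Either one of the two indices is even, or both orders are, and then so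
is the gcd factor in `residueIndex_mul`. -/
theorem two_dvd_residueIndex_mul (ha : 2 < a) (hb : 2 < b) (hab : a.Coprime b)
    (h : m.Coprime (a * b)) : 2 ∣ residueIndex m (a * b) := by
  have : NeZero a := ⟨by omega⟩
  have : NeZero b := ⟨by omega⟩
  have h1 := (Nat.totient_even ha).two_dvd
  have h2 := (Nat.totient_even hb).two_dvd
  rw [← residueIndex_mul_orderOf (h.coprime_dvd_right (Dvd.intro _ rfl)),
    Nat.prime_two.dvd_mul] at h1
  rw [← residueIndex_mul_orderOf (h.coprime_dvd_right (Dvd.intro_left _ rfl)),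
    Nat.prime_two.dvd_mul] at h2
  rw [residueIndex_mul hab h]
  rcases h1 with h1 | h1
  · exact (h1.mul_right _).mul_right _
  rcases h2 with h2 | h2
  · exact (h2.mul_left _).mul_right _
  · exact (Nat.dvd_gcd h1 h2).mul_left _

theorem residueIndex_mul_eq_gcd [NeZero a] [NeZero b] (hab : a.Coprime b) (h : m.Coprime (a * b))
    (ha : residueIndex m a = 1) (hb : residueIndex m b = 1) :
    residueIndex m (a * b) = a.totient.gcd b.totient := by
  rw [residueIndex_mul hab h, ha, hb,
    (residueIndex_eq_iff (h.coprime_dvd_right (Dvd.intro _ rfl))).mp ha,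
    (residueIndex_eq_iff (h.coprime_dvd_right (Dvd.intro_left _ rfl))).mp hb]
  ring_nf

theorem residueIndex_eq_one_of_totient_eq_one [NeZero d] (h : m.Coprime d)
    (hd : d.totient = 1) : residueIndex m d = 1 :=
  Nat.eq_one_of_mul_eq_one_right ((residueIndex_mul_orderOf h).trans hd)

theorem residueIndex_two_mul [NeZero a] (ha : Odd a) (h : m.Coprime (2 * a)) :
    residueIndex m (2 * a) = residueIndex m a := by
  have h2 : m.Coprime 2 := h.coprime_dvd_right (Dvd.intro _ rfl)
  have h3 := residueIndex_mul_orderOf h2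
  rw [Nat.totient_two] at h3
  rw [residueIndex_mul (Nat.coprime_two_left.mpr ha) h, Nat.eq_one_of_mul_eq_one_right h3,
    Nat.eq_one_of_mul_eq_one_left h3]
  simp

/-- An even index makes the order of `m` modulo `q ^ (k + 1)`, and with it the order modulo `q`,
divide `q ^ k * ((q - 1) / 2)`. The latter order divides `q - 1`, so it is prime to `q` and divides
`(q - 1) / 2`. -/
theorem two_dvd_residueIndex_of_prime_pow {q k : ℕ} (hq : q.Prime) (hq2 : q ≠ 2)
    (hm : m.Coprime q) (h : 2 ∣ residueIndex m (q ^ (k + 1))) : 2 ∣ residueIndex m q := by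
  have : NeZero q := ⟨hq.ne_zero⟩
  have hm' : m.Coprime (q ^ (k + 1)) := hm.pow_right _
  obtain ⟨t, ht⟩ := (hq.even_sub_one hq2).two_dvd
  obtain ⟨s, hs⟩ := h
  have h1 := residueIndex_mul_orderOf hm'
  have h2 := residueIndex_mul_orderOf hm
  have h3 : orderOf (m : ZMod q) ∣ orderOf (m : ZMod (q ^ (k + 1))) := by
    have := orderOf_map_dvd (ZMod.castHom (dvd_pow_self q k.succ_ne_zero) (ZMod q)).toMonoidHom
      (m : ZMod (q ^ (k + 1)))
    simpa using this
  rw [Nat.totient_prime_pow_succ hq, hs, ht] at h1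
  replace h1 : s * orderOf (m : ZMod (q ^ (k + 1))) = q ^ k * t := by linarith
  rw [Nat.totient_prime hq] at h2
  have h4 : (orderOf (m : ZMod q)).Coprime (q ^ k) := by
    refine Nat.Coprime.pow_right _ (Nat.Coprime.coprime_dvd_left (Dvd.intro_left _ h2) ?_)
    exact ((Nat.coprime_self_sub_right hq.one_le).mpr (Nat.coprime_one_right q)).symm
  have h5 : orderOf (m : ZMod q) ∣ t :=
    h4.dvd_of_dvd_mul_left (h1 ▸ h3.mul_left s)
  obtain ⟨c, hc⟩ := h5
  refine ⟨c, Nat.eq_of_mul_eq_mul_right (orderOf_natCast_zmod_pos hm) ?_⟩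
  rw [h2, ht, hc]
  ring

theorem Nat.Coprime.mod_four (h : m.Coprime 4) : m ≡ 1 [MOD 4] ∨ m ≡ 3 [MOD 4] := by
  have h2 : m.Coprime 2 := h.coprime_dvd_right (by norm_num)
  rw [Nat.coprime_two_right, Nat.odd_iff] at h2
  unfold Nat.ModEq
  omega

theorem residueIndex_four_of_mod_eq_one (h : m ≡ 1 [MOD 4]) : residueIndex m 4 = 2 := by
  have h1 : (m : ZMod 4) = 1 := by
    rw [(ZMod.natCast_eq_natCast_iff _ _ _).mpr h, Nat.cast_one]
  rw [residueIndex, h1, orderOf_one]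
  decide

theorem residueIndex_four_of_mod_eq_three (h : m ≡ 3 [MOD 4]) : residueIndex m 4 = 1 := by
  have h1 : (m : ZMod 4) = 3 := by
    rw [(ZMod.natCast_eq_natCast_iff _ _ _).mpr h, Nat.cast_ofNat]
  have h2 : orderOf (3 : ZMod 4) = 2 := orderOf_eq_prime (by decide) (by decide)
  rw [residueIndex, h1, h2]
  decide

theorem orderOf_natCast_zmod_eight_dvd (h : m.Coprime 8) : orderOf (m : ZMod 8) ∣ 2 := by
  rw [orderOf_dvd_iff_pow_eq_one, ← ZMod.coe_unitOfCoprime m h, ← Units.val_pow_eq_pow_val]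
  rw [show ∀ u : (ZMod 8)ˣ, u ^ 2 = 1 by decide, Units.val_one]

theorem two_dvd_residueIndex_eight (h : m.Coprime 8) : 2 ∣ residueIndex m 8 := by
  obtain ⟨c, hc⟩ := orderOf_natCast_zmod_eight_dvd h
  refine ⟨c, (residueIndex_eq_iff h).mpr ?_⟩
  rw [mul_assoc, mul_comm c, ← hc]
  decide

theorem residueIndex_eight_of_mod_eq_three (h : m ≡ 3 [MOD 4]) : residueIndex m 8 = 2 := by
  have hcop : m.Coprime 8 := by
    have : m.Coprime 2 := by
      rw [Nat.coprime_two_right, Nat.odd_iff]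
      unfold Nat.ModEq at h
      omega
    exact this.pow_right 3
  have h1 : (m : ZMod 8) ≠ 1 := by
    intro h1
    rw [← Nat.cast_one, ZMod.natCast_eq_natCast_iff] at h1
    unfold Nat.ModEq at h h1
    omega
  have h2 := (Nat.dvd_prime Nat.prime_two).mp (orderOf_natCast_zmod_eight_dvd hcop)
  rw [residueIndex, h2.resolve_left (by rwa [orderOf_eq_one_iff])]
  decide

theorem exists_prime_mul_dvd_of_dvd_of_ne (hn : n ≠ 0) (hd : d ∣ n) (hdn : d ≠ n) :
    ∃ l, l.Prime ∧ l * d ∣ n := by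
  obtain ⟨c, rfl⟩ := hd
  obtain ⟨l, hl, k, rfl⟩ := Nat.exists_prime_and_dvd (n := c) (by rintro rfl; simp at hdn)
  exact ⟨l, hl, k, by ring⟩

/-- The moduli `n` minimal for divisibility among those for which `m` is not a primitive root, and
for which moreover `m` generates a subgroup of index two. -/
theorem residueIndex_eq_two_minimal_iff (hn : n ≠ 0) (hm2 : m.Coprime 2) (h : m.Coprime n) :
    (residueIndex m n = 2 ∧ ∀ d, d ∣ n → d ≠ n → residueIndex m d = 1) ↔
      (((n = 4 ∧ m ≡ 1 [MOD 4]) ∨ (n = 8 ∧ m ≡ 3 [MOD 4])) ∨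
        (n.Prime ∧ n ≠ 2 ∧ orderOf (m : ZMod n) = (n - 1) / 2) ∨
        (∃ q : ℕ, q.Prime ∧ q ≠ 2 ∧ n = 4 * q ∧ m ≡ 3 [MOD 4] ∧ IsPrimitiveRootMod m q) ∨
        (∃ q₁ q₂ : ℕ, q₁.Prime ∧ q₂.Prime ∧ q₁ ≠ q₂ ∧ n = q₁ * q₂ ∧
          IsPrimitiveRootMod m q₁ ∧ IsPrimitiveRootMod m q₂ ∧
          Nat.gcd (q₁ - 1) (q₂ - 1) = 2)) := by
  have : NeZero n := ⟨hn⟩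
  have hm4 : m.Coprime 4 := hm2.pow_right 2
  have hm8 : m.Coprime 8 := hm2.pow_right 3
  constructor
  · rintro ⟨h2, hmin⟩
    -- Minimality is used in this form: a divisor of even index must be `n` itself. The divisors
    -- exhibited below are `q * r`, `4 * q`, `q` and `8`.
    have hmin' : ∀ d, d ∣ n → 2 ∣ residueIndex m d → d = n := by
      intro d hd h2d
      by_contra hdn
      rw [hmin d hd hdn] at h2d
      omega
    have hcop : ∀ d, d ∣ n → m.Coprime d := fun d hd => h.coprime_dvd_right hd
    by_cases hodd : ∃ q, q.Prime ∧ q ≠ 2 ∧ q ∣ n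
    · obtain ⟨q, hq, hq2, hqn⟩ := hodd
      have : NeZero q := ⟨hq.ne_zero⟩
      have hq3 : 2 < q := by have := hq.two_le; omega
      by_cases hodd' : ∃ r, r.Prime ∧ r ≠ 2 ∧ r ≠ q ∧ r ∣ n
      · obtain ⟨r, hr, hr2, hrq, hrn⟩ := hodd'
        have : NeZero r := ⟨hr.ne_zero⟩
        have hr3 : 2 < r := by have := hr.two_le; omega
        have hqr : q.Coprime r := (Nat.coprime_primes hq hr).mpr hrq.symm
        have hd : q * r ∣ n := hqr.mul_dvd_of_dvd_of_dvd hqn hrn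
        have hnqr := hmin' _ hd (two_dvd_residueIndex_mul hq3 hr3 hqr (hcop _ hd))
        have hq1 := hmin q hqn (by rw [← hnqr]; nlinarith)
        have hr1 := hmin r hrn (by rw [← hnqr]; nlinarith)
        refine Or.inr (Or.inr (Or.inr ⟨q, r, hq, hr, hrq.symm, hnqr.symm,
          (isPrimitiveRootMod_iff (hcop q hqn)).mpr hq1,
          (isPrimitiveRootMod_iff (hcop r hrn)).mpr hr1, ?_⟩))
        rw [← Nat.totient_prime hq, ← Nat.totient_prime hr,
          ← residueIndex_mul_eq_gcd hqr (hcop _ hd) hq1 hr1, hnqr, h2]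
      · push Not at hodd'
        by_cases h4 : 4 ∣ n
        · have h4q : (4 : ℕ).Coprime q :=
            Nat.Coprime.pow_left 2 ((Nat.coprime_primes Nat.prime_two hq).mpr hq2.symm)
          have hd : 4 * q ∣ n := h4q.mul_dvd_of_dvd_of_dvd h4 hqn
          have hn4q := hmin' _ hd (two_dvd_residueIndex_mul (by norm_num) hq3 h4q (hcop _ hd))
          have hq1 := hmin q hqn (by rw [← hn4q]; omega)
          have h41 := hmin 4 h4 (by rw [← hn4q]; omega)
          refine Or.inr (Or.inr (Or.inl ⟨q, hq, hq2, hn4q.symm, ?_,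
            (isPrimitiveRootMod_iff (hcop q hqn)).mpr hq1⟩))
          refine hm4.mod_four.resolve_left fun h1 => ?_
          rw [residueIndex_four_of_mod_eq_one h1] at h41
          omega
        · obtain ⟨k, c, hc, rfl⟩ := Nat.exists_eq_pow_mul_and_not_dvd hn q hq.ne_one
          have hk : k ≠ 0 := by
            rintro rfl
            rw [pow_zero, one_mul] at hqn
            exact hc hqn
          obtain ⟨k, rfl⟩ := Nat.exists_eq_add_one_of_ne_zero hk
          have hqk : Odd (q ^ (k + 1)) := (hq.odd_of_ne_two hq2).pow
          have hc12 : c = 1 ∨ c = 2 := by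
            by_cases hc1 : c = 1
            · exact Or.inl hc1
            · obtain ⟨l, hl, hlc⟩ := Nat.exists_prime_and_dvd hc1
              have hl2 : ∀ l, l.Prime → l ∣ c → l = 2 := by
                intro l hl hlc
                by_contra hl2
                exact hodd' l hl hl2 (by rintro rfl; exact hc hlc) (hlc.mul_left _)
              obtain rfl := hl2 l hl hlc
              obtain ⟨e, rfl⟩ := hlc
              by_cases he1 : e = 1
              · exact Or.inr (by rw [he1])
              · obtain ⟨l, hl, hle⟩ := Nat.exists_prime_and_dvd he1
                obtain rfl := hl2 l hl (hle.mul_left _)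
                obtain ⟨e, rfl⟩ := hle
                exact absurd ⟨q ^ (k + 1) * e, by ring⟩ h4
          rcases hc12 with rfl | rfl
          · rw [mul_one] at *
            have hqm := hcop q hqn
            have hqeq := hmin' q hqn
              (two_dvd_residueIndex_of_prime_pow hq hq2 hqm (by rw [h2]))
            rw [← hqeq] at h2 ⊢
            refine Or.inr (Or.inl ⟨hq, hq2, ?_⟩)
            rw [residueIndex_eq_iff hqm, Nat.totient_prime hq] at h2
            omega
          -- A factor 2 does not change the index of an odd modulus, so `n = 2 * q ^ (k + 1)`
          -- contradicts minimality.
          · rw [mul_comm, residueIndex_two_mul hqk (by rwa [mul_comm])] at h2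
            have := hmin' (q ^ (k + 1)) (Dvd.intro _ rfl) (by rw [h2])
            have : 0 < q ^ (k + 1) := pow_pos hq.pos _
            omega
    · push Not at hodd
      by_cases h8 : 8 ∣ n
      · have hn8 := hmin' 8 h8 (two_dvd_residueIndex_eight hm8)
        have h41 := hmin 4 (dvd_trans (by norm_num) h8) (by omega)
        refine Or.inl (Or.inr ⟨hn8.symm, hm4.mod_four.resolve_left fun h1 => ?_⟩)
        rw [residueIndex_four_of_mod_eq_one h1] at h41
        omega
      · obtain ⟨k, c, hc, rfl⟩ := Nat.exists_eq_pow_mul_and_not_dvd hn 2 (by norm_num)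
        have hc1 : c = 1 := by
          by_contra hc1
          obtain ⟨l, hl, hlc⟩ := Nat.exists_prime_and_dvd hc1
          exact hodd l hl (by rintro rfl; exact hc hlc) (hlc.mul_left _)
        subst hc1
        rw [mul_one] at *
        have hk : k < 3 := by
          by_contra! hk
          exact h8 (pow_dvd_pow 2 hk)
        interval_cases k
        · rw [residueIndex_eq_one_of_totient_eq_one h (by decide)] at h2
          omega
        · rw [residueIndex_eq_one_of_totient_eq_one h (by decide)] at h2
          omega
        · refine Or.inl (Or.inl ⟨rfl, hm4.mod_four.resolve_right fun h3 => ?_⟩)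
          have := residueIndex_four_of_mod_eq_three h3
          norm_num at h2
          omega
  -- Index 1 passes to divisors, so in the composite cases it suffices to check the quotients of `n`
  -- by a prime.
  · have hone : ∀ d e, d ∣ e → e ≠ 0 → m.Coprime e → residueIndex m e = 1 →
        residueIndex m d = 1 := by
      intro d e hde he hme h1
      have : NeZero e := ⟨he⟩
      exact Nat.dvd_one.mp (h1 ▸ residueIndex_dvd_of_dvd hme hde)
    rintro ((⟨rfl, h1⟩ | ⟨rfl, h3⟩) | ⟨hp, hp2, ho⟩ | ⟨q, hq, hq2, rfl, h3, hprim⟩ |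
      ⟨q, r, hq, hr, hqr, rfl, hpq, hpr, hgcd⟩)
    · refine ⟨residueIndex_four_of_mod_eq_one h1, fun d hd hdn => ?_⟩
      obtain ⟨l, hl, hld⟩ := exists_prime_mul_dvd_of_dvd_of_ne hn hd hdn
      obtain rfl := (Nat.prime_dvd_prime_iff_eq hl Nat.prime_two).mp
        (hl.dvd_of_dvd_pow (n := 2) ((Dvd.intro _ rfl).trans hld))
      exact hone d 2 (Nat.dvd_of_mul_dvd_mul_left two_pos hld) two_ne_zero hm2
        (residueIndex_eq_one_of_totient_eq_one hm2 (by decide))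
    · refine ⟨residueIndex_eight_of_mod_eq_three h3, fun d hd hdn => ?_⟩
      obtain ⟨l, hl, hld⟩ := exists_prime_mul_dvd_of_dvd_of_ne hn hd hdn
      obtain rfl := (Nat.prime_dvd_prime_iff_eq hl Nat.prime_two).mp
        (hl.dvd_of_dvd_pow (n := 3) ((Dvd.intro _ rfl).trans hld))
      exact hone d 4 (Nat.dvd_of_mul_dvd_mul_left two_pos hld) (by norm_num) hm4
        (residueIndex_four_of_mod_eq_three h3)
    · refine ⟨?_, fun d hd hdn => ?_⟩
      · rw [residueIndex_eq_iff h, Nat.totient_prime hp, ho,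
          Nat.mul_div_cancel' (hp.even_sub_one hp2).two_dvd]
      · obtain rfl := ((Nat.dvd_prime hp).mp hd).resolve_right hdn
        exact residueIndex_eq_one_of_totient_eq_one (Nat.coprime_one_right m) Nat.totient_one
    · have : NeZero q := ⟨hq.ne_zero⟩
      have hmq : m.Coprime q := hprim.1
      rw [isPrimitiveRootMod_iff hmq] at hprim
      have h4q : (4 : ℕ).Coprime q :=
        Nat.Coprime.pow_left 2 ((Nat.coprime_primes Nat.prime_two hq).mpr hq2.symm)
      have h41 := residueIndex_four_of_mod_eq_three h3
      refine ⟨?_, fun d hd hdn => ?_⟩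
      · rw [residueIndex_mul_eq_gcd h4q h h41 hprim, Nat.totient_prime hq]
        exact Nat.gcd_eq_left (hq.even_sub_one hq2).two_dvd
      · obtain ⟨l, hl, hld⟩ := exists_prime_mul_dvd_of_dvd_of_ne hn hd hdn
        rcases hl.dvd_mul.mp ((Dvd.intro _ rfl).trans hld) with hl' | hl'
        · obtain rfl := (Nat.prime_dvd_prime_iff_eq hl Nat.prime_two).mp
            (hl.dvd_of_dvd_pow (n := 2) hl')
          have hm2q : m.Coprime (2 * q) := hm2.mul_right hmq
          refine hone d (2 * q) (Nat.dvd_of_mul_dvd_mul_left two_pos ?_) (by have := hq.pos; omega)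
            hm2q ?_
          · rwa [← mul_assoc]
          · rw [residueIndex_two_mul (hq.odd_of_ne_two hq2) hm2q, hprim]
        · obtain rfl := (Nat.prime_dvd_prime_iff_eq hl hq).mp hl'
          refine hone d 4 (Nat.dvd_of_mul_dvd_mul_left hl.pos ?_) (by norm_num) hm4 h41
          rwa [mul_comm l 4]
    · have : NeZero q := ⟨hq.ne_zero⟩
      have : NeZero r := ⟨hr.ne_zero⟩
      have hmq : m.Coprime q := hpq.1
      have hmr : m.Coprime r := hpr.1
      rw [isPrimitiveRootMod_iff hmq] at hpq
      rw [isPrimitiveRootMod_iff hmr] at hpr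
      refine ⟨?_, fun d hd hdn => ?_⟩
      · rw [residueIndex_mul_eq_gcd ((Nat.coprime_primes hq hr).mpr hqr) h hpq hpr,
          Nat.totient_prime hq, Nat.totient_prime hr, hgcd]
      · obtain ⟨l, hl, hld⟩ := exists_prime_mul_dvd_of_dvd_of_ne hn hd hdn
        rcases hl.dvd_mul.mp ((Dvd.intro _ rfl).trans hld) with hl' | hl'
        · obtain rfl := (Nat.prime_dvd_prime_iff_eq hl hq).mp hl'
          exact hone d r (Nat.dvd_of_mul_dvd_mul_left hl.pos hld) hr.ne_zero hmr hpr
        · obtain rfl := (Nat.prime_dvd_prime_iff_eq hl hr).mp hl'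
          refine hone d q (Nat.dvd_of_mul_dvd_mul_left hl.pos ?_) hq.ne_zero hmq hpq
          rwa [mul_comm l q]

end ResidueIndex

/-! ### Criteria for the group ring and the theorem -/

section GroupRing

variable {p : ℕ} [Fact p.Prime]

theorem card_maximalSpectrum_ZLocZeta {d : ℕ} (hpd : ¬ p ∣ d) :
    Nat.card (MaximalSpectrum (ZLocZeta p d)) = residueIndex p d := by
  have : NeZero d := ⟨fun h => hpd (h ▸ dvd_zero p)⟩
  refine ((residueIndex_eq_iff ((Fact.out : p.Prime).coprime_iff_not_dvd.mpr hpd)).mpr ?_).symm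
  exact (natCard_maximalSpectrum_ZLocZeta_mul_orderOf hpd).symm

theorem residueIndex_pos {d : ℕ} (hpd : ¬ p ∣ d) : 0 < residueIndex p d := by
  have hd : 0 < d := Nat.pos_of_ne_zero fun h => hpd (h ▸ dvd_zero p)
  have : NeZero d := ⟨hd.ne'⟩
  have h := residueIndex_mul_orderOf ((Fact.out : p.Prime).coprime_iff_not_dvd.mpr hpd)
  refine Nat.pos_of_ne_zero fun h0 => ?_
  rw [h0, zero_mul] at h
  exact (Nat.totient_pos.mpr hd).ne h

theorem finite_maximalSpectrum_ZLocZeta {d : ℕ} (hpd : ¬ p ∣ d) :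
    Finite (MaximalSpectrum (ZLocZeta p d)) := by
  refine Nat.finite_of_card_ne_zero ?_
  rw [card_maximalSpectrum_ZLocZeta hpd]
  exact (residueIndex_pos hpd).ne'

theorem isUnit_two_ZLocZeta (hp2 : p ≠ 2) (d : ℕ) : IsUnit (2 : ZLocZeta p d) := by
  have h := ZLoc.isUnit_natCast p (m := 2) fun h =>
    hp2 ((Nat.prime_dvd_prime_iff_eq Fact.out Nat.prime_two).mp h)
  have h' := h.map (algebraMap (ZLoc p) (ZLocZeta p d))
  rwa [map_natCast, Nat.cast_ofNat] at h'

theorem isCleanRing_ZLocZeta_iff {d : ℕ} (hpd : ¬ p ∣ d) :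
    IsCleanRing (ZLocZeta p d) ↔ residueIndex p d = 1 := by
  have := finite_maximalSpectrum_ZLocZeta hpd
  rw [isCleanRing_iff_card_maximalSpectrum, card_maximalSpectrum_ZLocZeta hpd]

theorem isFeeblyCleanRing_ZLocZeta_iff (hp2 : p ≠ 2) {d : ℕ} (hpd : ¬ p ∣ d) :
    IsFeeblyCleanRing (ZLocZeta p d) ↔ residueIndex p d ≤ 2 := by
  have := finite_maximalSpectrum_ZLocZeta hpd
  rw [isFeeblyCleanRing_iff_card_maximalSpectrum (isUnit_two_ZLocZeta hp2 d),
    card_maximalSpectrum_ZLocZeta hpd]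

variable {G : Type*} [CommGroup G]

theorem isCyclic_iff_nonempty_equiv_multiplicative_zmod_exponent :
    IsCyclic G ↔ Nonempty (G ≃* Multiplicative (ZMod (Monoid.exponent G))) := by
  constructor
  · intro h
    rw [IsCyclic.exponent_eq_card]
    exact ⟨(zmodCyclicMulEquiv h).symm⟩
  · rintro ⟨e⟩
    exact isCyclic_of_surjective e.symm e.symm.surjective

variable [Finite G]

theorem nonempty_characters_equiv (G : Type*) [CommGroup G] [Finite G] :
    Nonempty ((G →* ℂˣ) ≃* G) := by
  have : NeZero (Monoid.exponent G) := ⟨Monoid.exponent_ne_zero_of_finite⟩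
  exact CommGroup.monoidHom_mulEquiv_of_hasEnoughRootsOfUnity G ℂ

theorem exponent_characters (G : Type*) [CommGroup G] [Finite G] :
    Monoid.exponent (G →* ℂˣ) = Monoid.exponent G := by
  obtain ⟨e⟩ := nonempty_characters_equiv G
  exact Monoid.exponent_eq_of_mulEquiv e

theorem orderOf_character_dvd (χ : G →* ℂˣ) : orderOf χ ∣ Monoid.exponent G :=
  exponent_characters G ▸ Monoid.order_dvd_exponent χ

/-- The character group is isomorphic to `G`, so some character has order equal to the exponent; a
suitable power of it has order `d`. -/
theorem exists_character_orderOf_eq {d : ℕ} (hd : d ∣ Monoid.exponent G) :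
    ∃ χ : G →* ℂˣ, orderOf χ = d := by
  obtain ⟨χ, hχ⟩ := Monoid.exists_orderOf_eq_exponent
    (Monoid.ExponentExists.of_finite (G := G →* ℂˣ))
  rw [exponent_characters] at hχ
  have hn : Monoid.exponent G ≠ 0 := Monoid.exponent_ne_zero_of_finite
  refine ⟨χ ^ (Monoid.exponent G / d), ?_⟩
  rw [orderOf_pow χ, hχ, Nat.gcd_eq_right (Nat.div_dvd_of_dvd hd), Nat.div_div_self hd hn]

theorem orderOf_eq_of_charKer_eq (hpG : ¬ p ∣ Monoid.exponent G) {χ ψ : G →* ℂˣ}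
    (h : charKer p χ = charKer p ψ) : orderOf χ = orderOf ψ := by
  rw [← Nat.card_zpowers, ← Nat.card_zpowers, (charKer_eq_iff hpG).mp h]

theorem isCleanRing_monoidAlgebra_iff (hpG : ¬ p ∣ Monoid.exponent G) :
    IsCleanRing (MonoidAlgebra (ZLoc p) G) ↔ residueIndex p (Monoid.exponent G) = 1 := by
  have hn : NeZero (Monoid.exponent G) := ⟨Monoid.exponent_ne_zero_of_finite⟩
  have hcop := (Fact.out : p.Prime).coprime_iff_not_dvd.mpr hpG
  obtain ⟨e⟩ := nonempty_monoidAlgebra_equiv_pi hpG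
  rw [isCleanRing_congr e, isCleanRing_pi_iff]
  have hdvd (P : CharKernels G p) := orderOf_character_dvd P.char
  have hpd (P : CharKernels G p) : ¬ p ∣ orderOf P.char := fun h => hpG (h.trans (hdvd P))
  simp only [isCleanRing_ZLocZeta_iff (hpd _)]
  constructor
  · intro h
    obtain ⟨χ, hχ⟩ := exists_character_orderOf_eq (G := G) dvd_rfl
    have := h ⟨_, χ, rfl⟩
    rwa [orderOf_eq_of_charKer_eq hpG (CharKernels.charKer_char _), hχ] at this
  · intro h P
    exact Nat.dvd_one.mp (h ▸ residueIndex_dvd_of_dvd hcop (hdvd P))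

theorem isFeeblyCleanRing_monoidAlgebra_iff (hp2 : p ≠ 2) (hpG : ¬ p ∣ Monoid.exponent G) :
    IsFeeblyCleanRing (MonoidAlgebra (ZLoc p) G) ↔ residueIndex p (Monoid.exponent G) ≤ 2 := by
  have hn : NeZero (Monoid.exponent G) := ⟨Monoid.exponent_ne_zero_of_finite⟩
  have hcop := (Fact.out : p.Prime).coprime_iff_not_dvd.mpr hpG
  obtain ⟨e⟩ := nonempty_monoidAlgebra_equiv_pi hpG
  rw [isFeeblyCleanRing_congr e, isFeeblyCleanRing_pi_iff]
  have hdvd (P : CharKernels G p) := orderOf_character_dvd P.char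
  have hpd (P : CharKernels G p) : ¬ p ∣ orderOf P.char := fun h => hpG (h.trans (hdvd P))
  simp only [isFeeblyCleanRing_ZLocZeta_iff hp2 (hpd _)]
  constructor
  · intro h
    obtain ⟨χ, hχ⟩ := exists_character_orderOf_eq (G := G) dvd_rfl
    have := h ⟨_, χ, rfl⟩
    rwa [orderOf_eq_of_charKer_eq hpG (CharKernels.charKer_char _), hχ] at this
  · intro h P
    exact (Nat.le_of_dvd (residueIndex_pos hpG) (residueIndex_dvd_of_dvd hcop (hdvd P))).trans h

/-- Exactly one factor has index 2 and the others have index 1. The index at the exponent is a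
multiple of all of them, so every character of maximal order has the exceptional kernel. These
characters then generate one and the same cyclic subgroup, which must be everything by
`exists_orderOf_eq_exponent_notMem_zpowers`. In the cyclic case, conversely, all characters of
maximal order generate, hence give a single factor. -/
theorem isWeaklyCleanRing_monoidAlgebra_and_not_isCleanRing_iff (hp2 : p ≠ 2)
    (hpG : ¬ p ∣ Monoid.exponent G) :
    IsWeaklyCleanRing (MonoidAlgebra (ZLoc p) G) ∧ ¬ IsCleanRing (MonoidAlgebra (ZLoc p) G) ↔
      IsCyclic G ∧ residueIndex p (Monoid.exponent G) = 2 ∧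
        ∀ d, d ∣ Monoid.exponent G → d ≠ Monoid.exponent G → residueIndex p d = 1 := by
  have hn : NeZero (Monoid.exponent G) := ⟨Monoid.exponent_ne_zero_of_finite⟩
  have hcop := (Fact.out : p.Prime).coprime_iff_not_dvd.mpr hpG
  obtain ⟨e⟩ := nonempty_monoidAlgebra_equiv_pi hpG
  obtain ⟨eG⟩ := nonempty_characters_equiv G
  have hdvd (P : CharKernels G p) := orderOf_character_dvd P.char
  have hpd (P : CharKernels G p) : ¬ p ∣ orderOf P.char := fun h => hpG (h.trans (hdvd P))
  have (P : CharKernels G p) := finite_maximalSpectrum_ZLocZeta (hpd P)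
  have hord (χ : G →* ℂˣ) : orderOf (CharKernels.char (p := p) ⟨_, χ, rfl⟩) = orderOf χ :=
    orderOf_eq_of_charKer_eq hpG (CharKernels.charKer_char _)
  rw [isWeaklyCleanRing_congr e, isCleanRing_congr e,
    isWeaklyCleanRing_pi_and_not_isCleanRing_iff fun P => isUnit_two_ZLocZeta hp2 _]
  simp only [card_maximalSpectrum_ZLocZeta (hpd _)]
  obtain ⟨χ, hχ⟩ := exists_character_orderOf_eq (G := G) dvd_rfl
  constructor
  · rintro ⟨P, hP, hP'⟩
    have hmax : ∀ ψ : G →* ℂˣ, orderOf ψ = Monoid.exponent G → charKer p ψ = P.1 := by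
      intro ψ hψ
      by_contra hne
      have h1 := hP' ⟨_, ψ, rfl⟩ (fun h => hne (congrArg Subtype.val h))
      rw [hord, hψ] at h1
      have h2 := residueIndex_dvd_of_dvd hcop (hdvd P)
      rw [h1, hP] at h2
      omega
    have hPn : orderOf P.char = Monoid.exponent G := by
      rw [← hχ]
      exact orderOf_eq_of_charKer_eq hpG (P.charKer_char.trans (hmax χ hχ).symm)
    refine ⟨?_, hPn ▸ hP, fun d hd hdn => ?_⟩
    · have htop : Subgroup.zpowers χ = ⊤ := by
        by_contra htop
        obtain ⟨ψ, hψ, hψχ⟩ := exists_orderOf_eq_exponent_notMem_zpowers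
          (hχ.trans (exponent_characters G).symm) htop
        have := (charKer_eq_iff hpG).mp
          ((hmax χ hχ).trans (hmax ψ (hψ.trans (exponent_characters G))).symm)
        exact hψχ (this ▸ Subgroup.mem_zpowers ψ)
      have : IsCyclic (G →* ℂˣ) :=
        ⟨χ, fun ψ => Subgroup.mem_zpowers_iff.mp (by rw [htop]; exact Subgroup.mem_top ψ)⟩
      exact isCyclic_of_surjective eG eG.surjective
    · obtain ⟨ψ, hψ⟩ := exists_character_orderOf_eq hd
      have := hP' ⟨_, ψ, rfl⟩ fun h => hdn <| by
        rw [← hψ, ← hPn, ← hord ψ, h]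
      rwa [hord, hψ] at this
  · rintro ⟨hcyc, h2, h1⟩
    refine ⟨⟨_, χ, rfl⟩, by rwa [hord, hχ], fun P hP => h1 _ (hdvd P) fun hPn => hP ?_⟩
    refine Subtype.ext (P.charKer_char.symm.trans (charKer_eq_of_zpowers_eq ?_))
    have hcard : Nat.card (G →* ℂˣ) = Monoid.exponent G := by
      rw [Nat.card_congr eG.toEquiv, IsCyclic.exponent_eq_card]
    have htop : ∀ ψ : G →* ℂˣ, orderOf ψ = Monoid.exponent G → Subgroup.zpowers ψ = ⊤ := by
      intro ψ hψ
      exact Subgroup.eq_top_of_card_eq _ (by rw [Nat.card_zpowers, hψ, hcard])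
    rw [htop _ hPn, htop χ hχ]

end GroupRing

theorem theorem3p1 (p : ℕ) [Fact p.Prime] (hp2 : p ≠ 2)
    (G : Type*) [CommGroup G] [Finite G] (n : ℕ) (hn : Monoid.exponent G = n) (hpn : ¬ p ∣ n) :
    ((IsCleanRing (MonoidAlgebra (ZLoc p) G) ↔ IsCleanRing (ZLocZeta p n)) ∧
      (IsCleanRing (ZLocZeta p n) ↔ IsPrimitiveRootMod p n)) ∧
    ((IsFeeblyCleanRing (MonoidAlgebra (ZLoc p) G) ∧ ¬ IsCleanRing (MonoidAlgebra (ZLoc p) G) ↔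
        IsFeeblyCleanRing (ZLocZeta p n) ∧ ¬ IsCleanRing (ZLocZeta p n)) ∧
      (IsFeeblyCleanRing (ZLocZeta p n) ∧ ¬ IsCleanRing (ZLocZeta p n) ↔
        Nat.totient n = 2 * orderOf (p : ZMod n))) ∧
    (IsWeaklyCleanRing (MonoidAlgebra (ZLoc p) G) ∧ ¬ IsCleanRing (MonoidAlgebra (ZLoc p) G) ↔
      Nonempty (G ≃* Multiplicative (ZMod n)) ∧
        (((n = 4 ∧ p ≡ 1 [MOD 4]) ∨ (n = 8 ∧ p ≡ 3 [MOD 4])) ∨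
          (n.Prime ∧ n ≠ 2 ∧ orderOf (p : ZMod n) = (n - 1) / 2) ∨
          (∃ q : ℕ, q.Prime ∧ q ≠ 2 ∧ n = 4 * q ∧ p ≡ 3 [MOD 4] ∧ IsPrimitiveRootMod p q) ∨
          (∃ q₁ q₂ : ℕ, q₁.Prime ∧ q₂.Prime ∧ q₁ ≠ q₂ ∧ n = q₁ * q₂ ∧
            IsPrimitiveRootMod p q₁ ∧ IsPrimitiveRootMod p q₂ ∧
            Nat.gcd (q₁ - 1) (q₂ - 1) = 2))) := by
  subst hn
  have hp : p.Prime := Fact.out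
  have hn : NeZero (Monoid.exponent G) := ⟨Monoid.exponent_ne_zero_of_finite⟩
  have hcop : p.Coprime (Monoid.exponent G) := hp.coprime_iff_not_dvd.mpr hpn
  have hpos := residueIndex_pos hpn
  refine ⟨⟨?_, ?_⟩, ⟨?_, ?_⟩, ?_⟩
  · rw [isCleanRing_monoidAlgebra_iff hpn, isCleanRing_ZLocZeta_iff hpn]
  · rw [isCleanRing_ZLocZeta_iff hpn, isPrimitiveRootMod_iff hcop]
  · rw [isCleanRing_monoidAlgebra_iff hpn, isCleanRing_ZLocZeta_iff hpn,
      isFeeblyCleanRing_monoidAlgebra_iff hp2 hpn, isFeeblyCleanRing_ZLocZeta_iff hp2 hpn]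
  · rw [isCleanRing_ZLocZeta_iff hpn, isFeeblyCleanRing_ZLocZeta_iff hp2 hpn,
      ← residueIndex_eq_iff hcop]
    omega
  · rw [isWeaklyCleanRing_monoidAlgebra_and_not_isCleanRing_iff hp2 hpn,
      isCyclic_iff_nonempty_equiv_multiplicative_zmod_exponent,
      residueIndex_eq_two_minimal_iff hn.ne ((Nat.coprime_primes hp Nat.prime_two).mpr hp2) hcop]
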